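/- Conventions. Let $\mathcal C$ be a category with finite products. A $\mathcal C$-indexed category is a pseudofunctor $\mathcal L:\mathcal C^{op}\to\mathbf{CAT}$; $f^*=\mathcal L(f)$ denotes reindexing, and $\Sigma_{\mathcal C}\mathcal L$ is its Grothendieck construction: objects are pairs $(X,x)$ with $x\in\mathcal L(X)$, and morphisms $(X,x)\to(Y,y)$ are pairs $(f:X\to Y,\ \varphi:x\to f^*y)$. (1) Let $\mathcal C':\mathcal C^{op}\to\mathbf{CAT}$ be a model of dependent type theory with $\Pi$-types and strong $\Sigma$-types, that is, an indexed category with: * indexed terminal objects (terminal objects $1$ of the fibres, preserved by reindexing); they give a functor $1:\mathcal C\to\Sigma_{\mathcal C}\mathcal C'$, $W\mapsto(W,1)$; * comprehension: a right adjoint $(W,w)\mapsto W.w$ of this functor. The counit at $(W,w)$ consists of a projection $p:W.w\to W$ and a generic element $1\to p^*w$; for $f:W'\to W$ write $q:W'.f^*w\to W.w$ for the induced map over $f$; * $\Pi$-types: right adjoints $\Pi_w$ of $p^*:\mathcal C'(W)\to\mathcal C'(W.w)$, such that the canonical maps $f^*\Pi_w\to\Pi_{f^*w}q^*$ are invertible;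 * strong $\Sigma$-types: left adjoints $\Sigma_w$ of $p^*$, such that the canonical maps $\Sigma_{f^*w}q^*\to f^*\Sigma_w$ and $W.w.w'\to W.\Sigma_w w'$ are invertible. Assume moreover that every object $X$ of $\mathcal C$ is isomorphic to $1.\ulcorner X\urcorner$ for some $\ulcorner X\urcorner\in\mathcal C'(1)$ (for instance, that comprehension gives an equivalence $\mathcal C'(1)\simeq\mathcal C$), and fix such objects and isomorphisms. We write $X$ also for the context $1.\ulcorner X\urcorner$ and for the type $\ulcorner X\urcorner$, and $Y$ also for its weakening to any context. (2) Let $\mathcal L:\mathcal C^{op}\to\mathbf{CAT}$ be an indexed category with non-dependent $\Pi$-types: for all $W,X$ the functor $\pi_1^*:\mathcal L(W)\to\mathcal L(W\times X)$ has a right adjoint $\Pi_X$, and the canonical maps $f^*\Pi_X\to\Pi_X(f\times X)^*$ are invertible for all $f:W'\to W$. Let $\mathcal L$ carry an indexed monoidal structure: monoidal structures on the fibres, with reindexing functors strong monoidal and the structure isomorphisms of the pseudofunctor monoidal. Then $\Sigma_{\mathcal C}\mathcal L$ is monoidal with $(X,x)\otimes(Y,y)=(X\times Y,\pi_1^*x\otimes\pi_2^*y)$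 and unit $(1,I)$. (3) An *indexed $\Sigma,\mathcal C'$-cotractable structure* on the tensor product of $\mathcal L$ consists of an indexed (pseudonatural) functor $T(-)\multimap(-):\mathcal L^{op}\times\mathcal L\to\mathcal C'$, an indexed functor $\partial$ from the comma categories $1\downarrow\bigl(T(-)\multimap(-)\bigr)$ (whose objects over $W$ are triples $(b,a,g)$ with $b,a\in\mathcal L(W)$ and $g:1\to Tb\multimap a$ in $\mathcal C'(W)$) to $\mathcal L$, and bijections $$\mathcal L(W)(b\otimes c,\,a)\;\cong\;\Sigma_{g\in\mathcal C'(W)(1,\,Tb\multimap a)}\ \mathcal L(W)\bigl(c,\,\partial(b,a,g)\bigr)$$ natural in $a,b,c$ and compatible with reindexing along the maps of $\mathcal C$. Theorem. Suppose the tensor product of $\mathcal L$ is indexed $\Sigma,\mathcal C'$-cotractable. Then $\Sigma_{\mathcal C}\mathcal L$ is monoidal left-closed, i.e. every functor $(X,x)\otimes(-)$ has a right adjoint $(X,x)\multimap(-)$, and this right adjoint is given on objects by $$(X,x)\multimap(Y,y)=\bigl(\Pi_X\Sigma_Y(Tx\multimap y),\ \Pi_X\,\zeta^*(\partial v)\bigr).$$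 Here $Tx\multimap y$ is formed in the context $X.Y$ from the reindexings of $x$ and $y$ along the two projections; the closed type $\Pi_X\Sigma_Y(Tx\multimap y)\in\mathcal C'(1)$ also denotes the object $1.\Pi_X\Sigma_Y(Tx\multimap y)$ of $\mathcal C$; $v:1\to Tx\multimap y$ in $\mathcal C'(X.Y.(Tx\multimap y))$ is the generic element of $Tx\multimap y$, so that $\partial v\in\mathcal L(X.Y.(Tx\multimap y))$; and $$\zeta:\ \Pi_X\Sigma_Y(Tx\multimap y)\times X\ \longrightarrow\ X.\Sigma_Y(Tx\multimap y)\ \cong\ X.Y.(Tx\multimap y)$$ is the second projection paired with the evaluation of the generic element of the $\Pi$-type (the counit of $p^*\dashv\Pi_X$), followed by the canonical isomorphism. If instead the reversed tensor product $(b,c)\mapsto c\otimes b$ of $\mathcal L$ is indexed $\Sigma,\mathcal C'$-cotractable, then $\Sigma_{\mathcal C}\mathcal L$ is monoidal right-closed: every functor $(-)\otimes(X,x)$ has a right adjoint, given on objects by the same formula. -/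

import Mathlib

open CategoryTheory Opposite MonoidalCategory

universe v u v' u' v₁ u₁ v₂ u₂

namespace Dialectica

section Base

variable {C : Type u} [Category.{v} C]

set_option linter.checkUnivs false in
/-- A `C`-indexed category: a pseudofunctor `Cᵒᵖ ⥤ CAT`. -/
abbrev IndexedCat (C : Type u) [Category.{v} C] :=
  Pseudofunctor (LocallyDiscrete Cᵒᵖ) Cat.{v', u'}

variable (L : IndexedCat.{v, u, v', u'} C)

/-- The fibre `L(X)`. -/
abbrev fib (X : C) : Type u' := L.obj ⟨op X⟩

/-- The reindexing functor `L(f) : L(Y) ⥤ L(X)`. -/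
def re {X Y : C} (f : X ⟶ Y) : fib L Y ⥤ fib L X := (L.map f.op.toLoc).toFunctor

/-- The (inverse) unitor `L(𝟙) ≅ 𝟭`. -/
def reId (X : C) : re L (𝟙 X) ≅ 𝟭 (fib L X) := Cat.Hom.toNatIso (L.mapId ⟨op X⟩)

/-- The compositor `L(f) ∘ L(g) ≅ L(h)` where `h = g ∘ f`. -/
def reComp {X Y Z : C} (f : X ⟶ Y) (g : Y ⟶ Z) (h : X ⟶ Z) (w : f ≫ g = h) :
    re L g ⋙ re L f ≅ re L h :=
  (Cat.Hom.toNatIso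
    (L.mapComp' g.op.toLoc f.op.toLoc h.op.toLoc (by subst w; rfl))).symm

/-- The component `L(f)(L(g)(z)) ≅ L(h)(z)` of the compositor. -/
def reC {X Y Z : C} (f : X ⟶ Y) (g : Y ⟶ Z) (h : X ⟶ Z) (w : f ≫ g = h) (z : fib L Z) :
    (re L f).obj ((re L g).obj z) ≅ (re L h).obj z := (reComp L f g h w).app z

/-- The component `L(𝟙)(x) ≅ x` of the (inverse) unitor. -/
def reI {X : C} (x : fib L X) : (re L (𝟙 X)).obj x ≅ x := (reId L X).app x

lemma reC_natural {X Y Z : C} (f : X ⟶ Y) (g : Y ⟶ Z) (h : X ⟶ Z) (w : f ≫ g = h)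
    {z z' : fib L Z} (t : z ⟶ z') :
    (re L f).map ((re L g).map t) ≫ (reC L f g h w z').hom =
      (reC L f g h w z).hom ≫ (re L h).map t :=
  (reComp L f g h w).hom.naturality t

lemma reC_natural_assoc {X Y Z : C} (f : X ⟶ Y) (g : Y ⟶ Z) (h : X ⟶ Z) (w : f ≫ g = h)
    {z z' : fib L Z} (t : z ⟶ z') {y : fib L X} (k : (re L h).obj z' ⟶ y) :
    (re L f).map ((re L g).map t) ≫ (reC L f g h w z').hom ≫ k =
      (reC L f g h w z).hom ≫ (re L h).map t ≫ k := by
  rw [← Category.assoc, reC_natural, Category.assoc]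

lemma reI_natural {X : C} {x x' : fib L X} (t : x ⟶ x') :
    (re L (𝟙 X)).map t ≫ (reI L x').hom = (reI L x).hom ≫ t :=
  (reId L X).hom.naturality t

lemma reC_assoc {W X Y Z : C} (f : W ⟶ X) (g : X ⟶ Y) (h : Y ⟶ Z)
    (fg : W ⟶ Y) (gh : X ⟶ Z) (k : W ⟶ Z) (w₁ : f ≫ g = fg) (w₂ : g ≫ h = gh)
    (w₃ : fg ≫ h = k) (w₄ : f ≫ gh = k) (z : fib L Z) :
    (reC L f g fg w₁ ((re L h).obj z)).hom ≫ (reC L fg h k w₃ z).hom =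
      (re L f).map (reC L g h gh w₂ z).hom ≫ (reC L f gh k w₄ z).hom := by
  have := congrArg (fun t => Cat.Hom₂.toNatTrans t)
    (L.whiskerLeft_mapComp'_inv_comp_mapComp'₀₁₃_inv h.op.toLoc g.op.toLoc f.op.toLoc
    gh.op.toLoc fg.op.toLoc k.op.toLoc (by subst w₂; rfl) (by subst w₁; rfl) (by subst w₃; rfl))
  have := congrArg (fun t => NatTrans.app t z) this
  simp at this
  exact this

lemma reC_id_left {X Y : C} (f : X ⟶ Y) (w : 𝟙 X ≫ f = f) (y : fib L Y) :
    (reC L (𝟙 X) f f w y).hom = (reI L ((re L f).obj y)).hom := by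
  have := congrArg (fun t => Cat.Hom₂.toNatTrans t) (L.mapComp'_comp_id_inv f.op.toLoc)
  have := congrArg (fun t => NatTrans.app t y) this
  simp at this
  exact this

lemma reC_id_right {X Y : C} (f : X ⟶ Y) (w : f ≫ 𝟙 Y = f) (y : fib L Y) :
    (reC L f (𝟙 Y) f w y).hom = (re L f).map (reI L y).hom := by
  have := congrArg (fun t => Cat.Hom₂.toNatTrans t) (L.mapComp'_id_comp_inv f.op.toLoc)
  have := congrArg (fun t => NatTrans.app t y) this
  simp at this
  exact this

/-- The Grothendieck construction `Σ_C L`. -/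
abbrev Total := Pseudofunctor.CoGrothendieck L

variable {L}

/-- The morphism `(f, φ)` of `Σ_C L`. -/
def tmk {x y : Total L} (f : x.base ⟶ y.base) (φ : x.fiber ⟶ (re L f).obj y.fiber) :
    x ⟶ y := ⟨f, φ⟩

/-- The base component of a morphism of `Σ_C L`. -/
def tbase {x y : Total L} (Φ : x ⟶ y) : x.base ⟶ y.base :=
  Pseudofunctor.CoGrothendieck.Hom.base Φ

/-- The fibre component of a morphism of `Σ_C L`. -/
def tfib {x y : Total L} (Φ : x ⟶ y) : x.fiber ⟶ (re L (tbase Φ)).obj y.fiber :=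
  Pseudofunctor.CoGrothendieck.Hom.fiber Φ

@[simp] lemma tbase_mk {x y : Total L} (f : x.base ⟶ y.base)
    (φ : x.fiber ⟶ (re L f).obj y.fiber) : tbase (tmk f φ) = f := rfl
@[simp] lemma tfib_mk {x y : Total L} (f : x.base ⟶ y.base)
    (φ : x.fiber ⟶ (re L f).obj y.fiber) : tfib (tmk f φ) = φ := rfl
@[simp] lemma tbase_id (x : Total L) : tbase (𝟙 x) = 𝟙 x.base := rfl
@[simp] lemma tbase_comp {x y z : Total L} (Φ : x ⟶ y) (Ψ : y ⟶ z) :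
    tbase (Φ ≫ Ψ) = tbase Φ ≫ tbase Ψ := rfl
lemma tfib_id (x : Total L) : tfib (𝟙 x) = (reI L x.fiber).inv := rfl
lemma tfib_comp {x y z : Total L} (Φ : x ⟶ y) (Ψ : y ⟶ z) :
    tfib (Φ ≫ Ψ) = tfib Φ ≫ (re L (tbase Φ)).map (tfib Ψ) ≫
      (reC L (tbase Φ) (tbase Ψ) (tbase (Φ ≫ Ψ)) rfl z.fiber).hom := by
  have : (reC L (tbase Φ) (tbase Ψ) (tbase (Φ ≫ Ψ)) rfl z.fiber).hom =
      (L.mapComp (tbase Ψ).op.toLoc (tbase Φ).op.toLoc).inv.toNatTrans.app z.fiber := by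
    unfold reC reComp
    erw [Pseudofunctor.mapComp'_eq_mapComp]
    rfl
  rw [this]; rfl

/-- The action of a morphism `x ⟶ y` of `Σ_C L` on the reindexing of `x` along `a`. -/
def cpt {x y : Total L} (Φ : x ⟶ y) {B : C} (a : B ⟶ x.base) (b : B ⟶ y.base)
    (w : a ≫ tbase Φ = b) : (re L a).obj x.fiber ⟶ (re L b).obj y.fiber :=
  (re L a).map (tfib Φ) ≫ (reC L a (tbase Φ) b w y.fiber).hom

lemma cpt_self {x y : Total L} (Φ : x ⟶ y) :
    cpt Φ (𝟙 _) (tbase Φ) (Category.id_comp _) = (reI L _).hom ≫ tfib Φ := by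
  simp only [cpt, reC_id_left]
  exact reI_natural L (tfib Φ)

lemma total_hom_ext {x y : Total L} {Φ Ψ : x ⟶ y} (f : x.base ⟶ y.base) (h₁ : tbase Φ = f)
    (h₂ : tbase Ψ = f)
    (h : cpt Φ (𝟙 _) f (by simp [h₁]) = cpt Ψ (𝟙 _) f (by simp [h₂])) : Φ = Ψ := by
  obtain ⟨f₁, φ⟩ := Φ
  obtain ⟨f₂, ψ⟩ := Ψ
  change f₁ = f at h₁
  change f₂ = f at h₂
  subst h₁
  subst h₂
  have e₁ := cpt_self (L := L) (x := x) (y := y) ⟨f₂, φ⟩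
  have e₂ := cpt_self (L := L) (x := x) (y := y) ⟨f₂, ψ⟩
  have := e₁.symm.trans (h.trans e₂)
  exact congrArg (Pseudofunctor.CoGrothendieck.Hom.mk f₂) ((cancel_epi _).1 this)

lemma cpt_id (x : Total L) {B : C} (a : B ⟶ x.base) (w : a ≫ tbase (𝟙 x) = a) :
    cpt (𝟙 x) a a w = 𝟙 _ := by
  have w' : a ≫ 𝟙 x.base = a := w
  change (re L a).map (reI L x.fiber).inv ≫ (reC L a (𝟙 _) a w' x.fiber).hom = _
  rw [reC_id_right, ← Functor.map_comp, Iso.inv_hom_id, CategoryTheory.Functor.map_id]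

lemma cpt_comp {x y z : Total L} (Φ : x ⟶ y) (Ψ : y ⟶ z) {B : C} (a : B ⟶ x.base)
    (b : B ⟶ y.base) (c : B ⟶ z.base) (w₁ : a ≫ tbase Φ = b) (w₂ : b ≫ tbase Ψ = c)
    (w₃ : a ≫ tbase (Φ ≫ Ψ) = c) :
    cpt (Φ ≫ Ψ) a c w₃ = cpt Φ a b w₁ ≫ cpt Ψ b c w₂ := by
  simp only [cpt, tfib_comp, Functor.map_comp, Category.assoc]
  rw [← reC_natural_assoc, reC_assoc L a (tbase Φ) (tbase Ψ) b (tbase (Φ ≫ Ψ)) c w₁ rfl w₂ w₃]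

/-- Reindexing a component along `c`. -/
lemma re_cpt {x y : Total L} (Φ : x ⟶ y) {A B : C} (c : A ⟶ B) (a : B ⟶ x.base)
    (b : B ⟶ y.base) (w : a ≫ tbase Φ = b) (ca : A ⟶ x.base) (cb : A ⟶ y.base)
    (h₁ : c ≫ a = ca) (h₂ : c ≫ b = cb) (w' : ca ≫ tbase Φ = cb) :
    (re L c).map (cpt Φ a b w) ≫ (reC L c b cb h₂ _).hom =
      (reC L c a ca h₁ _).hom ≫ cpt Φ ca cb w' := by
  simp only [cpt, Functor.map_comp, Category.assoc]
  rw [← reC_natural_assoc, reC_assoc L c a (tbase Φ) ca b cb h₁ w w' h₂]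

/-- A morphism of `Σ_C L` from its component at the identity. -/
def ofCpt {x y : Total L} (f : x.base ⟶ y.base)
    (κ : (re L (𝟙 x.base)).obj x.fiber ⟶ (re L f).obj y.fiber) : x ⟶ y :=
  tmk f ((reI L x.fiber).inv ≫ κ)

@[simp] lemma tbase_ofCpt {x y : Total L} (f : x.base ⟶ y.base)
    (κ : (re L (𝟙 x.base)).obj x.fiber ⟶ (re L f).obj y.fiber) : tbase (ofCpt f κ) = f := rfl

/-- A morphism of `Σ_C L` with invertible components is invertible. -/
def totalIso {x y : Total L} (e : x.base ≅ y.base) (φ : x.fiber ≅ (re L e.hom).obj y.fiber) :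
    x ≅ y :=
  have key : ∀ {B : C} (a : B ⟶ x.base) (b : B ⟶ y.base) (w : a ≫ e.hom = b)
      (w' : b ≫ e.inv = a),
      cpt (tmk (x := y) (y := x) e.inv ((reI L y.fiber).inv ≫
        (reC L e.inv e.hom (𝟙 _) e.inv_hom_id y.fiber).inv ≫ (re L e.inv).map φ.inv)) b a w' ≫
      cpt (tmk (x := x) (y := y) e.hom φ.hom) a b w = 𝟙 _ := by
    intro B a b w w'
    simp only [cpt, tfib_mk, tbase_mk, Functor.map_comp, Category.assoc]
    rw [reC_natural_assoc, ← Functor.map_comp_assoc (re L a), Iso.inv_hom_id,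
      CategoryTheory.Functor.map_id, Category.id_comp,
      reC_assoc L b e.inv e.hom a (𝟙 _) b w' e.inv_hom_id w (Category.comp_id b),
      ← Functor.map_comp_assoc (re L b) (Iso.inv _) (Iso.hom _), Iso.inv_hom_id,
      CategoryTheory.Functor.map_id, Category.id_comp, reC_id_right, ← Functor.map_comp,
      Iso.inv_hom_id, CategoryTheory.Functor.map_id]
  { hom := tmk e.hom φ.hom
    inv := tmk (x := y) (y := x) e.inv ((reI L y.fiber).inv ≫
      (reC L e.inv e.hom (𝟙 _) e.inv_hom_id y.fiber).inv ≫ (re L e.inv).map φ.inv)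
    hom_inv_id := by
      refine total_hom_ext (𝟙 _) (by simp) (by simp) ?_
      rw [cpt_comp _ _ (𝟙 _) e.hom (𝟙 _) (by simp) (by simp), cpt_id]
      have h1 : IsIso ((re L (𝟙 x.base)).map φ.hom) := inferInstance
      have h2 : IsIso (cpt (tmk (x := x) (y := y) e.hom φ.hom) (𝟙 _) e.hom (by simp)) := by
        unfold cpt
        exact IsIso.comp_isIso' h1 inferInstance
      refine (cancel_mono (cpt (tmk (x := x) (y := y) e.hom φ.hom) (𝟙 _) e.hom (by simp))).1 ?_
      exact (Category.assoc _ _ _).trans ((congrArg (_ ≫ ·) (key _ _ (by simp) (by simp))).trans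
        ((Category.comp_id _).trans (Category.id_comp _).symm))
    inv_hom_id := by
      refine total_hom_ext (𝟙 _) (by simp) (by simp) ?_
      rw [cpt_comp _ _ (𝟙 _) e.inv (𝟙 _) (by simp) (by simp), cpt_id]
      exact key _ _ _ _ }

/-- The components of a morphism built from a family that is natural in the stage. -/
lemma cpt_ofCpt {x y : Total L} (f : x.base ⟶ y.base)
    (κ : ∀ {B : C} (a : B ⟶ x.base) (b : B ⟶ y.base), a ≫ f = b →
      ((re L a).obj x.fiber ⟶ (re L b).obj y.fiber))
    (nat : ∀ {A B : C} (c : A ⟶ B) (a : B ⟶ x.base) (b : B ⟶ y.base) (w : a ≫ f = b)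
      (ca : A ⟶ x.base) (cb : A ⟶ y.base) (h₁ : c ≫ a = ca) (h₂ : c ≫ b = cb)
      (w' : ca ≫ f = cb),
      (re L c).map (κ a b w) ≫ (reC L c b cb h₂ _).hom =
        (reC L c a ca h₁ _).hom ≫ κ ca cb w')
    {B : C} (a : B ⟶ x.base) (b : B ⟶ y.base) (w : a ≫ f = b) :
    cpt (ofCpt f (κ (𝟙 _) f (Category.id_comp f))) a b w = κ a b w := by
  have h := nat a (𝟙 _) f (Category.id_comp f) a b (Category.comp_id a) w w
  change (re L a).map ((reI L x.fiber).inv ≫ κ (𝟙 _) f (Category.id_comp f)) ≫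
    (reC L a f b w y.fiber).hom = _
  rw [Functor.map_comp, Category.assoc, h, reC_id_right, ← Functor.map_comp_assoc, Iso.inv_hom_id]
  simp

lemma sq_ext {x y y' z : Total L} {f : x ⟶ y} {g : y ⟶ z} {f' : x ⟶ y'} {g' : y' ⟶ z}
    (b : x.base ⟶ y.base) (b' : x.base ⟶ y'.base) (c : x.base ⟶ z.base)
    (h₁ : tbase f = b) (h₂ : b ≫ tbase g = c) (h₁' : tbase f' = b') (h₂' : b' ≫ tbase g' = c)
    (h : cpt f (𝟙 _) b (by simp [h₁]) ≫ cpt g b c h₂ =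
      cpt f' (𝟙 _) b' (by simp [h₁']) ≫ cpt g' b' c h₂') : f ≫ g = f' ≫ g' := by
  refine total_hom_ext c (by simp [h₁, h₂]) (by simp [h₁', h₂']) ?_
  rw [cpt_comp f g (𝟙 _) b c (by simp [h₁]) h₂, cpt_comp f' g' (𝟙 _) b' c (by simp [h₁']) h₂', h]

end Base

section Monoidal

open CartesianMonoidalCategory Functor.LaxMonoidal Functor.OplaxMonoidal Functor.Monoidal

variable {C : Type u} [Category.{v} C]

/-- An indexed monoidal structure on `L`: monoidal structures on the fibres, strong monoidal
structures on the reindexing functors, and monoidality of the unitors and compositors. -/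
class IndexedMonoidal (L : IndexedCat.{v, u, v', u'} C) where
  mon (X : C) : MonoidalCategory (fib L X)
  reMon {X Y : C} (f : X ⟶ Y) : (re L f).Monoidal
  reId_isMonoidal (X : C) : NatTrans.IsMonoidal (reId L X).hom
  reComp_isMonoidal {X Y Z : C} (f : X ⟶ Y) (g : Y ⟶ Z) (h : X ⟶ Z) (w : f ≫ g = h) :
    NatTrans.IsMonoidal (reComp L f g h w).hom

attribute [reducible] IndexedMonoidal.mon IndexedMonoidal.reMon
attribute [instance] IndexedMonoidal.mon IndexedMonoidal.reMon IndexedMonoidal.reId_isMonoidal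
  IndexedMonoidal.reComp_isMonoidal

variable {L : IndexedCat.{v, u, v', u'} C} [IndexedMonoidal L]

lemma reC_unit {X Y Z : C} (f : X ⟶ Y) (g : Y ⟶ Z) (h : X ⟶ Z) (w : f ≫ g = h) :
    (reC L f g h w (𝟙_ (fib L Z))).hom ≫ η (re L h) =
      (re L f).map (η (re L g)) ≫ η (re L f) := by
  have h1 := NatTrans.IsMonoidal.unit (τ := (reComp L f g h w).hom)
  rw [← cancel_epi (ε (re L g ⋙ re L f))]
  rw [reassoc_of% (show ε (re L g ⋙ re L f) ≫ (reC L f g h w (𝟙_ (fib L Z))).hom = ε (re L h)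
    from h1)]
  simp [← Functor.map_comp_assoc]

lemma reC_tensor {X Y Z : C} (f : X ⟶ Y) (g : Y ⟶ Z) (h : X ⟶ Z) (w : f ≫ g = h)
    (P Q : fib L Z) :
    (reC L f g h w (P ⊗ Q)).hom ≫ δ (re L h) P Q =
      (re L f).map (δ (re L g) P Q) ≫ δ (re L f) _ _ ≫
        ((reC L f g h w P).hom ⊗ₘ (reC L f g h w Q).hom) := by
  have h1 := NatTrans.IsMonoidal.tensor (τ := (reComp L f g h w).hom) P Q
  rw [← cancel_epi (μ (re L g ⋙ re L f) P Q)]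
  rw [reassoc_of% (show μ (re L g ⋙ re L f) P Q ≫ (reC L f g h w (P ⊗ Q)).hom =
    ((reC L f g h w P).hom ⊗ₘ (reC L f g h w Q).hom) ≫ μ (re L h) P Q from h1)]
  simp [← Functor.map_comp_assoc]

lemma reC_tensor_assoc {X Y Z : C} (f : X ⟶ Y) (g : Y ⟶ Z) (h : X ⟶ Z) (w : f ≫ g = h)
    (P Q : fib L Z) {y : fib L X} (k : (re L h).obj P ⊗ (re L h).obj Q ⟶ y) :
    (reC L f g h w (P ⊗ Q)).hom ≫ δ (re L h) P Q ≫ k =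
      (re L f).map (δ (re L g) P Q) ≫ δ (re L f) _ _ ≫
        ((reC L f g h w P).hom ⊗ₘ (reC L f g h w Q).hom) ≫ k := by
  rw [← Category.assoc, reC_tensor]
  simp only [Category.assoc]

variable [CartesianMonoidalCategory C]

/-- `a^*(π₁^* x ⊗ π₂^* y) ≅ (π₁ a)^* x ⊗ (π₂ a)^* y`. -/
def tens {X Y B : C} (x : fib L X) (y : fib L Y) (a : B ⟶ X ⊗ Y) (a₁ : B ⟶ X) (a₂ : B ⟶ Y)
    (h₁ : a ≫ fst X Y = a₁) (h₂ : a ≫ snd X Y = a₂) :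
    (re L a).obj ((re L (fst X Y)).obj x ⊗ (re L (snd X Y)).obj y) ≅
      (re L a₁).obj x ⊗ (re L a₂).obj y :=
  (μIso (re L a) _ _).symm ≪≫ (reC L a _ a₁ h₁ x ⊗ᵢ reC L a _ a₂ h₂ y)

/-- `c^*` of a tensor product of reindexed objects. -/
def rten {X Y A B : C} (x : fib L X) (y : fib L Y) (c : A ⟶ B) (a₁ : B ⟶ X) (a₂ : B ⟶ Y)
    (b₁ : A ⟶ X) (b₂ : A ⟶ Y) (h₁ : c ≫ a₁ = b₁) (h₂ : c ≫ a₂ = b₂) :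
    (re L c).obj ((re L a₁).obj x ⊗ (re L a₂).obj y) ⟶ (re L b₁).obj x ⊗ (re L b₂).obj y :=
  δ (re L c) _ _ ≫ ((reC L c a₁ b₁ h₁ x).hom ⊗ₘ (reC L c a₂ b₂ h₂ y).hom)

lemma re_tens {X Y A B : C} (x : fib L X) (y : fib L Y) (c : A ⟶ B) (a : B ⟶ X ⊗ Y)
    (a₁ : B ⟶ X) (a₂ : B ⟶ Y) (h₁ : a ≫ fst X Y = a₁) (h₂ : a ≫ snd X Y = a₂)
    (b : A ⟶ X ⊗ Y) (b₁ : A ⟶ X) (b₂ : A ⟶ Y) (k₁ : b ≫ fst X Y = b₁) (k₂ : b ≫ snd X Y = b₂)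
    (w : c ≫ a = b) (w₁ : c ≫ a₁ = b₁) (w₂ : c ≫ a₂ = b₂) :
    (reC L c a b w _).hom ≫ (tens x y b b₁ b₂ k₁ k₂).hom =
      (re L c).map (tens x y a a₁ a₂ h₁ h₂).hom ≫ rten x y c a₁ a₂ b₁ b₂ w₁ w₂ := by
  simp only [tens, rten, Iso.trans_hom, Iso.symm_hom, μIso_inv, tensorIso_hom, Functor.map_comp,
    Category.assoc, reC_tensor_assoc, tensorHom_comp_tensorHom]
  rw [← δ_natural_assoc, tensorHom_comp_tensorHom,
    reC_assoc L c a _ b a₁ b₁ w h₁ k₁ w₁ x, reC_assoc L c a _ b a₂ b₂ w h₂ k₂ w₂ y]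

lemma re_tens_assoc {X Y A B : C} (x : fib L X) (y : fib L Y) (c : A ⟶ B) (a : B ⟶ X ⊗ Y)
    (a₁ : B ⟶ X) (a₂ : B ⟶ Y) (h₁ : a ≫ fst X Y = a₁) (h₂ : a ≫ snd X Y = a₂)
    (b : A ⟶ X ⊗ Y) (b₁ : A ⟶ X) (b₂ : A ⟶ Y) (k₁ : b ≫ fst X Y = b₁) (k₂ : b ≫ snd X Y = b₂)
    (w : c ≫ a = b) (w₁ : c ≫ a₁ = b₁) (w₂ : c ≫ a₂ = b₂) {z : fib L A}
    (k : (re L b₁).obj x ⊗ (re L b₂).obj y ⟶ z) :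
    (reC L c a b w _).hom ≫ (tens x y b b₁ b₂ k₁ k₂).hom ≫ k =
      (re L c).map (tens x y a a₁ a₂ h₁ h₂).hom ≫ rten x y c a₁ a₂ b₁ b₂ w₁ w₂ ≫ k := by
  rw [← Category.assoc, re_tens x y c a a₁ a₂ h₁ h₂ b b₁ b₂ k₁ k₂ w w₁ w₂, Category.assoc]

/-- The tensor product on objects of `Σ_C L`. -/
abbrev tobj (x y : Total L) : Total L :=
  ⟨x.base ⊗ y.base, (re L (fst x.base y.base)).obj x.fiber ⊗ (re L (snd x.base y.base)).obj y.fiber⟩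

/-- Components of the tensor product of morphisms. -/
def tHomCpt {x x' y y' : Total L} (Φ : x ⟶ x') (Ψ : y ⟶ y') {B : C} (a : B ⟶ x.base ⊗ y.base)
    (b : B ⟶ x'.base ⊗ y'.base) (w : a ≫ (tbase Φ ⊗ₘ tbase Ψ) = b) :
    (re L a).obj (tobj x y).fiber ⟶ (re L b).obj (tobj x' y').fiber :=
  (tens x.fiber y.fiber a _ _ rfl rfl).hom ≫
    (cpt Φ (a ≫ fst _ _) (b ≫ fst _ _) (by simp [← w]) ⊗ₘ
      cpt Ψ (a ≫ snd _ _) (b ≫ snd _ _) (by simp [← w])) ≫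
    (tens x'.fiber y'.fiber b _ _ rfl rfl).inv

/-- The tensor product of morphisms of `Σ_C L`. -/
def tHom {x x' y y' : Total L} (Φ : x ⟶ x') (Ψ : y ⟶ y') : tobj x y ⟶ tobj x' y' :=
  ofCpt (tbase Φ ⊗ₘ tbase Ψ) (tHomCpt Φ Ψ (𝟙 _) _ (Category.id_comp _))

@[simp] lemma tbase_tHom {x x' y y' : Total L} (Φ : x ⟶ x') (Ψ : y ⟶ y') :
    tbase (tHom Φ Ψ) = (tbase Φ ⊗ₘ tbase Ψ) := rfl

lemma cpt_tHom' {x x' y y' : Total L} (Φ : x ⟶ x') (Ψ : y ⟶ y') {B : C} (a : B ⟶ x.base ⊗ y.base)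
    (b : B ⟶ x'.base ⊗ y'.base) (w : a ≫ (tbase Φ ⊗ₘ tbase Ψ) = b) :
    cpt (tHom Φ Ψ) a b w = tHomCpt Φ Ψ a b w := by
  refine cpt_ofCpt (x := tobj x y) (y := tobj x' y') (tbase Φ ⊗ₘ tbase Ψ)
    (fun a b w => tHomCpt Φ Ψ a b w) ?_ a b w
  intro A B c a b w ca cb h₁ h₂ w'
  dsimp only [tHomCpt]
  rw [← cancel_mono (tens x'.fiber y'.fiber cb _ _ rfl rfl).hom]
  simp only [Functor.map_comp, Category.assoc, Iso.inv_hom_id, Category.comp_id]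
  rw [re_tens x'.fiber y'.fiber c b _ _ rfl rfl cb _ _ rfl rfl h₂ (by simp [← h₂]) (by simp [← h₂]),
    re_tens_assoc x.fiber y.fiber c a _ _ rfl rfl ca _ _ rfl rfl h₁ (by simp [← h₁])
      (by simp [← h₁])]
  rw [← Functor.map_comp_assoc (re L c) (Iso.inv _), Iso.inv_hom_id]
  simp only [CategoryTheory.Functor.map_id, Category.id_comp, rten, Category.assoc]
  rw [← δ_natural_assoc, tensorHom_comp_tensorHom, tensorHom_comp_tensorHom]
  rw [re_cpt Φ c _ _ _ (ca ≫ fst _ _) (cb ≫ fst _ _) (by simp [← h₁]) (by simp [← h₂])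
      (by simp [← w']),
    re_cpt Ψ c _ _ _ (ca ≫ snd _ _) (cb ≫ snd _ _) (by simp [← h₁]) (by simp [← h₂])
      (by simp [← w'])]

lemma cpt_tHom {x x' y y' : Total L} (Φ : x ⟶ x') (Ψ : y ⟶ y') {B : C} (a : B ⟶ x.base ⊗ y.base)
    (b : B ⟶ x'.base ⊗ y'.base) (w : a ≫ tbase (tHom Φ Ψ) = b) (a₁ : B ⟶ x.base)
    (a₂ : B ⟶ y.base) (b₁ : B ⟶ x'.base) (b₂ : B ⟶ y'.base) (h₁ : a ≫ fst _ _ = a₁)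
    (h₂ : a ≫ snd _ _ = a₂) (k₁ : b ≫ fst _ _ = b₁) (k₂ : b ≫ snd _ _ = b₂)
    (w₁ : a₁ ≫ tbase Φ = b₁) (w₂ : a₂ ≫ tbase Ψ = b₂) :
    cpt (tHom Φ Ψ) a b w = (tens x.fiber y.fiber a a₁ a₂ h₁ h₂).hom ≫
      (cpt Φ a₁ b₁ w₁ ⊗ₘ cpt Ψ a₂ b₂ w₂) ≫ (tens x'.fiber y'.fiber b b₁ b₂ k₁ k₂).inv := by
  subst h₁ h₂ k₁ k₂
  exact cpt_tHom' Φ Ψ a b w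

/-- The unit object of `Σ_C L`. -/
abbrev tunit (L : IndexedCat.{v, u, v', u'} C) [IndexedMonoidal L] : Total L :=
  ⟨𝟙_ C, 𝟙_ (fib L (𝟙_ C))⟩

/-- Threefold version of `tens`, bracketed to the left. -/
def tensL {X Y Z B : C} (x : fib L X) (y : fib L Y) (z : fib L Z) (a : B ⟶ (X ⊗ Y) ⊗ Z)
    (a₁ : B ⟶ X ⊗ Y) (p : B ⟶ X) (q : B ⟶ Y) (r : B ⟶ Z)
    (h₁ : a ≫ fst _ _ = a₁) (hp : a₁ ≫ fst _ _ = p) (hq : a₁ ≫ snd _ _ = q)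
    (hr : a ≫ snd _ _ = r) :
    (re L a).obj ((re L (fst (X ⊗ Y) Z)).obj ((re L (fst X Y)).obj x ⊗ (re L (snd X Y)).obj y) ⊗
      (re L (snd (X ⊗ Y) Z)).obj z) ≅
      ((re L p).obj x ⊗ (re L q).obj y) ⊗ (re L r).obj z :=
  tens _ z a a₁ r h₁ hr ≪≫ whiskerRightIso (tens x y a₁ p q hp hq) _

/-- Threefold version of `tens`, bracketed to the right. -/
def tensR {X Y Z B : C} (x : fib L X) (y : fib L Y) (z : fib L Z) (a : B ⟶ X ⊗ (Y ⊗ Z))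
    (a₂ : B ⟶ Y ⊗ Z) (p : B ⟶ X) (q : B ⟶ Y) (r : B ⟶ Z)
    (h₂ : a ≫ snd _ _ = a₂) (hp : a ≫ fst _ _ = p) (hq : a₂ ≫ fst _ _ = q)
    (hr : a₂ ≫ snd _ _ = r) :
    (re L a).obj ((re L (fst X (Y ⊗ Z))).obj x ⊗
      (re L (snd X (Y ⊗ Z))).obj ((re L (fst Y Z)).obj y ⊗ (re L (snd Y Z)).obj z)) ≅
      (re L p).obj x ⊗ ((re L q).obj y ⊗ (re L r).obj z) :=
  tens x _ a p a₂ hp h₂ ≪≫ whiskerLeftIso _ (tens y z a₂ q r hq hr)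

lemma re_tensL {X Y Z A B : C} (x : fib L X) (y : fib L Y) (z : fib L Z) (c : A ⟶ B)
    (a : B ⟶ (X ⊗ Y) ⊗ Z) (a₁ : B ⟶ X ⊗ Y) (p : B ⟶ X) (q : B ⟶ Y) (r : B ⟶ Z)
    (h₁ : a ≫ fst _ _ = a₁) (hp : a₁ ≫ fst _ _ = p) (hq : a₁ ≫ snd _ _ = q)
    (hr : a ≫ snd _ _ = r) (a' : A ⟶ (X ⊗ Y) ⊗ Z) (a₁' : A ⟶ X ⊗ Y) (p' : A ⟶ X) (q' : A ⟶ Y)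
    (r' : A ⟶ Z) (h₁' : a' ≫ fst _ _ = a₁') (hp' : a₁' ≫ fst _ _ = p') (hq' : a₁' ≫ snd _ _ = q')
    (hr' : a' ≫ snd _ _ = r') (w : c ≫ a = a') (w₁ : c ≫ a₁ = a₁') (wp : c ≫ p = p')
    (wq : c ≫ q = q') (wr : c ≫ r = r') :
    (reC L c a a' w _).hom ≫ (tensL x y z a' a₁' p' q' r' h₁' hp' hq' hr').hom =
      (re L c).map (tensL x y z a a₁ p q r h₁ hp hq hr).hom ≫ δ (re L c) _ _ ≫
        (rten x y c p q p' q' wp wq ⊗ₘ (reC L c r r' wr z).hom) := by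
  simp only [tensL, Iso.trans_hom, whiskerRightIso_hom, Functor.map_comp, Category.assoc]
  rw [re_tens_assoc _ z c a a₁ r h₁ hr a' a₁' r' h₁' hr' w w₁ wr, rten, Category.assoc,
    ← tensorHom_id, tensorHom_comp_tensorHom, Category.comp_id,
    re_tens x y c a₁ p q hp hq a₁' p' q' hp' hq' w₁ wp wq, ← δ_natural_left_assoc,
    ← tensorHom_id, tensorHom_comp_tensorHom, Category.id_comp]

lemma re_tensR {X Y Z A B : C} (x : fib L X) (y : fib L Y) (z : fib L Z) (c : A ⟶ B)
    (a : B ⟶ X ⊗ (Y ⊗ Z)) (a₂ : B ⟶ Y ⊗ Z) (p : B ⟶ X) (q : B ⟶ Y) (r : B ⟶ Z)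
    (h₂ : a ≫ snd _ _ = a₂) (hp : a ≫ fst _ _ = p) (hq : a₂ ≫ fst _ _ = q)
    (hr : a₂ ≫ snd _ _ = r) (a' : A ⟶ X ⊗ (Y ⊗ Z)) (a₂' : A ⟶ Y ⊗ Z) (p' : A ⟶ X) (q' : A ⟶ Y)
    (r' : A ⟶ Z) (h₂' : a' ≫ snd _ _ = a₂') (hp' : a' ≫ fst _ _ = p') (hq' : a₂' ≫ fst _ _ = q')
    (hr' : a₂' ≫ snd _ _ = r') (w : c ≫ a = a') (w₂ : c ≫ a₂ = a₂') (wp : c ≫ p = p')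
    (wq : c ≫ q = q') (wr : c ≫ r = r') :
    (reC L c a a' w _).hom ≫ (tensR x y z a' a₂' p' q' r' h₂' hp' hq' hr').hom =
      (re L c).map (tensR x y z a a₂ p q r h₂ hp hq hr).hom ≫ δ (re L c) _ _ ≫
        ((reC L c p p' wp x).hom ⊗ₘ rten y z c q r q' r' wq wr) := by
  simp only [tensR, Iso.trans_hom, whiskerLeftIso_hom, Functor.map_comp, Category.assoc]
  rw [re_tens_assoc x _ c a p a₂ hp h₂ a' p' a₂' hp' h₂' w wp w₂, rten, Category.assoc,
    ← id_tensorHom, tensorHom_comp_tensorHom, Category.comp_id,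
    re_tens y z c a₂ q r hq hr a₂' q' r' hq' hr' w₂ wq wr, ← δ_natural_right_assoc,
    ← id_tensorHom, tensorHom_comp_tensorHom, Category.id_comp]

lemma map_assoc_tensor {A B : Type*} [Category A] [Category B] [MonoidalCategory A]
    [MonoidalCategory B] (F : A ⥤ B) [F.Monoidal] {P Q R : A} {P' Q' R' : B}
    (f : F.obj P ⟶ P') (g : F.obj Q ⟶ Q') (h : F.obj R ⟶ R') :
    F.map (α_ P Q R).hom ≫ δ F P (Q ⊗ R) ≫ (f ⊗ₘ (δ F Q R ≫ (g ⊗ₘ h))) =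
      δ F (P ⊗ Q) R ≫ ((δ F P Q ≫ (f ⊗ₘ g)) ⊗ₘ h) ≫ (α_ P' Q' R').hom := by
  rw [← whiskerLeft_comp_tensorHom, ← whiskerRight_comp_tensorHom, Category.assoc,
    associator_naturality, Functor.OplaxMonoidal.associativity_assoc]

lemma map_leftUnitor_tensor {A B : Type*} [Category A] [Category B] [MonoidalCategory A]
    [MonoidalCategory B] (F : A ⥤ B) [F.Monoidal] {U P : A} {U' P' : B} (e : U ⟶ 𝟙_ A)
    (e' : U' ⟶ 𝟙_ B) (s : F.obj U ⟶ U') (f : F.obj P ⟶ P') (h : s ≫ e' = F.map e ≫ η F) :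
    F.map (e ▷ P) ≫ F.map (λ_ P).hom ≫ f =
      δ F U P ≫ (s ⊗ₘ f) ≫ e' ▷ P' ≫ (λ_ P').hom := by
  rw [← left_unitality_hom, Category.assoc, Category.assoc, ← δ_natural_left_assoc,
    ← leftUnitor_naturality, ← tensorHom_id, ← tensorHom_id, ← tensorHom_id, ← id_tensorHom]
  simp only [tensorHom_comp_tensorHom_assoc, Category.comp_id, Category.id_comp, h]

lemma map_rightUnitor_tensor {A B : Type*} [Category A] [Category B] [MonoidalCategory A]
    [MonoidalCategory B] (F : A ⥤ B) [F.Monoidal] {U P : A} {U' P' : B} (e : U ⟶ 𝟙_ A)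
    (e' : U' ⟶ 𝟙_ B) (s : F.obj U ⟶ U') (f : F.obj P ⟶ P') (h : s ≫ e' = F.map e ≫ η F) :
    F.map (P ◁ e) ≫ F.map (ρ_ P).hom ≫ f =
      δ F P U ≫ (f ⊗ₘ s) ≫ P' ◁ e' ≫ (ρ_ P').hom := by
  rw [← right_unitality_hom, Category.assoc, Category.assoc, ← δ_natural_right_assoc,
    ← rightUnitor_naturality, ← tensorHom_id, ← id_tensorHom, ← id_tensorHom, ← id_tensorHom]
  simp only [tensorHom_comp_tensorHom_assoc, Category.comp_id, Category.id_comp, h]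

/-- Components of the associator. -/
def assocCpt (x y z : Total L) {B : C} (a : B ⟶ (x.base ⊗ y.base) ⊗ z.base)
    (b : B ⟶ x.base ⊗ (y.base ⊗ z.base)) (a₁ : B ⟶ x.base ⊗ y.base)
    (b₂ : B ⟶ y.base ⊗ z.base) (p : B ⟶ x.base) (q : B ⟶ y.base) (r : B ⟶ z.base)
    (h₁ : a ≫ fst _ _ = a₁) (hp : a₁ ≫ fst _ _ = p) (hq : a₁ ≫ snd _ _ = q)
    (hr : a ≫ snd _ _ = r) (h₂ : b ≫ snd _ _ = b₂) (kp : b ≫ fst _ _ = p)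
    (kq : b₂ ≫ fst _ _ = q) (kr : b₂ ≫ snd _ _ = r) :
    (re L a).obj (tobj (tobj x y) z).fiber ≅ (re L b).obj (tobj x (tobj y z)).fiber :=
  tensL x.fiber y.fiber z.fiber a a₁ p q r h₁ hp hq hr ≪≫ α_ _ _ _ ≪≫
    (tensR x.fiber y.fiber z.fiber b b₂ p q r h₂ kp kq kr).symm

/-- The associator of `Σ_C L`. -/
def tassoc (x y z : Total L) : tobj (tobj x y) z ≅ tobj x (tobj y z) :=
  totalIso (x := tobj (tobj x y) z) (y := tobj x (tobj y z)) (α_ x.base y.base z.base)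
    ((reI L (tobj (tobj x y) z).fiber).symm ≪≫ assocCpt x y z (𝟙 _) (α_ _ _ _).hom
      (fst _ _) (snd _ _ ⊗ₘ 𝟙 _) (fst _ _ ≫ fst _ _) (fst _ _ ≫ snd _ _) (snd _ _)
      (by simp) rfl rfl (by simp) (by ext <;> simp) (by simp) (by simp) (by simp))

@[simp] lemma tbase_assoc (x y z : Total L) :
    tbase (tassoc x y z).hom = (α_ x.base y.base z.base).hom := rfl

lemma cpt_assoc (x y z : Total L) {B : C} (a : B ⟶ (x.base ⊗ y.base) ⊗ z.base)
    (b : B ⟶ x.base ⊗ (y.base ⊗ z.base)) (w : a ≫ tbase (tassoc x y z).hom = b)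
    (a₁ : B ⟶ x.base ⊗ y.base)
    (b₂ : B ⟶ y.base ⊗ z.base) (p : B ⟶ x.base) (q : B ⟶ y.base) (r : B ⟶ z.base)
    (h₁ : a ≫ fst _ _ = a₁) (hp : a₁ ≫ fst _ _ = p) (hq : a₁ ≫ snd _ _ = q)
    (hr : a ≫ snd _ _ = r) (h₂ : b ≫ snd _ _ = b₂) (kp : b ≫ fst _ _ = p)
    (kq : b₂ ≫ fst _ _ = q) (kr : b₂ ≫ snd _ _ = r) :
    cpt (tassoc x y z).hom a b w =
      (tensL x.fiber y.fiber z.fiber a a₁ p q r h₁ hp hq hr).hom ≫ (α_ _ _ _).hom ≫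
        (tensR x.fiber y.fiber z.fiber b b₂ p q r h₂ kp kq kr).inv := by
  have w0 : a ≫ (α_ x.base y.base z.base).hom = b := w
  subst h₁ hp hq hr h₂
  have key := cpt_ofCpt (x := tobj (tobj x y) z) (y := tobj x (tobj y z))
    (α_ x.base y.base z.base).hom
    (fun {B} a b w => (assocCpt x y z a b (a ≫ fst _ _) (b ≫ snd _ _) ((a ≫ fst _ _) ≫ fst _ _)
      ((a ≫ fst _ _) ≫ snd _ _) (a ≫ snd _ _) rfl rfl rfl rfl rfl (by simp [← w])
      (by simp [← w]) (by simp [← w])).hom) ?_ a b w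
  · refine Eq.trans ?_ key
    congr 1
    simp only [tassoc, totalIso, ofCpt]
    congr 1
    simp only [Iso.trans_hom, Iso.symm_hom]
    congr 3 <;> first | (simp; done) | (ext <;> simp)
  intro A B c a b w ca cb h₁ h₂ w'
  dsimp only [assocCpt, Iso.trans_hom, Iso.symm_hom]
  have e1 := re_tensR x.fiber y.fiber z.fiber c b (b ≫ snd _ _) ((a ≫ fst _ _) ≫ fst _ _)
      ((a ≫ fst _ _) ≫ snd _ _) (a ≫ snd _ _) rfl (by simp [← w]) (by simp [← w])
      (by simp [← w]) cb (cb ≫ snd _ _) ((ca ≫ fst _ _) ≫ fst _ _)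
      ((ca ≫ fst _ _) ≫ snd _ _) (ca ≫ snd _ _) rfl (by simp [← w']) (by simp [← w'])
      (by simp [← w']) h₂ (by simp [← h₂]) (by simp [← h₁]) (by simp [← h₁])
      (by simp [← h₁])
  have e2 := re_tensL x.fiber y.fiber z.fiber c a (a ≫ fst _ _) ((a ≫ fst _ _) ≫ fst _ _)
      ((a ≫ fst _ _) ≫ snd _ _) (a ≫ snd _ _) rfl rfl rfl rfl ca (ca ≫ fst _ _)
      ((ca ≫ fst _ _) ≫ fst _ _) ((ca ≫ fst _ _) ≫ snd _ _) (ca ≫ snd _ _) rfl rfl rfl rfl h₁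
      (by simp [← h₁]) (by simp [← h₁]) (by simp [← h₁]) (by simp [← h₁])
  rw [← cancel_mono (tensR x.fiber y.fiber z.fiber cb (cb ≫ snd _ _) ((ca ≫ fst _ _) ≫ fst _ _)
      ((ca ≫ fst _ _) ≫ snd _ _) (ca ≫ snd _ _) rfl (by simp [← w']) (by simp [← w'])
      (by simp [← w'])).hom]
  simp only [Functor.map_comp, Category.assoc, Iso.inv_hom_id, Category.comp_id]
  rw [e1, reassoc_of% e2]
  rw [← Functor.map_comp_assoc (re L c) (Iso.inv _), Iso.inv_hom_id]
  simp only [CategoryTheory.Functor.map_id, Category.id_comp, rten]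
  congr 1
  exact map_assoc_tensor (re L c) _ _ _

/-- Components of the left unitor. -/
def lunitCpt (x : Total L) {B : C} (a : B ⟶ 𝟙_ C ⊗ x.base) (b : B ⟶ x.base) (a₁ : B ⟶ 𝟙_ C)
    (h₁ : a ≫ fst _ _ = a₁) (h₂ : a ≫ snd _ _ = b) :
    (re L a).obj (tobj (tunit L) x).fiber ≅ (re L b).obj x.fiber :=
  tens (𝟙_ _) x.fiber a a₁ b h₁ h₂ ≪≫ whiskerRightIso (εIso (re L a₁)).symm _ ≪≫ λ_ _

/-- The left unitor of `Σ_C L`. -/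
def tlunit (x : Total L) : tobj (tunit L) x ≅ x :=
  totalIso (x := tobj (tunit L) x) (y := x) (λ_ x.base)
    ((reI L (tobj (tunit L) x).fiber).symm ≪≫
      lunitCpt x (𝟙 _) (λ_ _).hom (fst _ _) (by simp) (by simp [leftUnitor_hom]))

@[simp] lemma tbase_lunit (x : Total L) : tbase (tlunit x).hom = (λ_ x.base).hom := rfl

lemma cpt_lunit (x : Total L) {B : C} (a : B ⟶ 𝟙_ C ⊗ x.base) (b : B ⟶ x.base)
    (w : a ≫ tbase (tlunit x).hom = b) (a₁ : B ⟶ 𝟙_ C)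
    (h₁ : a ≫ fst _ _ = a₁) (h₂ : a ≫ snd _ _ = b) :
    cpt (tlunit x).hom a b w =
      (tens (𝟙_ _) x.fiber a a₁ b h₁ h₂).hom ≫ (η (re L a₁)) ▷ _ ≫ (λ_ _).hom := by
  subst h₁
  have key := cpt_ofCpt (x := tobj (tunit L) x) (y := x) (λ_ x.base).hom
    (fun {B} a b w => (lunitCpt x a b (a ≫ fst _ _) rfl (by simp [← w, leftUnitor_hom])).hom) ?_ a b w
  · refine Eq.trans ?_ key
    congr 1
    simp only [tlunit, totalIso, ofCpt]
    congr 1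
    simp only [Iso.trans_hom, Iso.symm_hom]
    congr 3
    simp
  intro A B c a b w ca cb h₁ h₂ w'
  dsimp only [lunitCpt, Iso.trans_hom, Iso.symm_hom, whiskerRightIso_hom, εIso_inv]
  rw [re_tens_assoc (𝟙_ (fib L (𝟙_ C))) x.fiber c a (a ≫ fst _ _) b rfl (by simp [← w, leftUnitor_hom]) ca
    (ca ≫ fst _ _) cb rfl (by simp [← w', leftUnitor_hom]) h₁ (by simp [← h₁]) h₂]
  simp only [Functor.map_comp, Category.assoc, rten]
  congr 1
  exact map_leftUnitor_tensor (re L c) _ _ _ _ (reC_unit _ _ _ _)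

/-- Components of the right unitor. -/
def runitCpt (x : Total L) {B : C} (a : B ⟶ x.base ⊗ 𝟙_ C) (b : B ⟶ x.base) (a₂ : B ⟶ 𝟙_ C)
    (h₁ : a ≫ fst _ _ = b) (h₂ : a ≫ snd _ _ = a₂) :
    (re L a).obj (tobj x (tunit L)).fiber ≅ (re L b).obj x.fiber :=
  tens x.fiber (𝟙_ _) a b a₂ h₁ h₂ ≪≫ whiskerLeftIso _ (εIso (re L a₂)).symm ≪≫ ρ_ _

/-- The right unitor of `Σ_C L`. -/
def trunit (x : Total L) : tobj x (tunit L) ≅ x :=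
  totalIso (x := tobj x (tunit L)) (y := x) (ρ_ x.base)
    ((reI L (tobj x (tunit L)).fiber).symm ≪≫
      runitCpt x (𝟙 _) (ρ_ _).hom (snd _ _) (by simp [rightUnitor_hom]) (by simp))

@[simp] lemma tbase_runit (x : Total L) : tbase (trunit x).hom = (ρ_ x.base).hom := rfl

lemma cpt_runit (x : Total L) {B : C} (a : B ⟶ x.base ⊗ 𝟙_ C) (b : B ⟶ x.base)
    (w : a ≫ tbase (trunit x).hom = b) (a₂ : B ⟶ 𝟙_ C)
    (h₁ : a ≫ fst _ _ = b) (h₂ : a ≫ snd _ _ = a₂) :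
    cpt (trunit x).hom a b w =
      (tens x.fiber (𝟙_ _) a b a₂ h₁ h₂).hom ≫ _ ◁ (η (re L a₂)) ≫ (ρ_ _).hom := by
  subst h₂
  have key := cpt_ofCpt (x := tobj x (tunit L)) (y := x) (ρ_ x.base).hom
    (fun {B} a b w => (runitCpt x a b (a ≫ snd _ _) (by simp [← w, rightUnitor_hom]) rfl).hom) ?_ a b w
  · refine Eq.trans ?_ key
    congr 1
    simp only [trunit, totalIso, ofCpt]
    congr 1
    simp only [Iso.trans_hom, Iso.symm_hom]
    congr 3
    simp
  intro A B c a b w ca cb h₁ h₂ w'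
  dsimp only [runitCpt, Iso.trans_hom, Iso.symm_hom, whiskerLeftIso_hom, εIso_inv]
  rw [re_tens_assoc x.fiber (𝟙_ (fib L (𝟙_ C))) c a b (a ≫ snd _ _) (by simp [← w, rightUnitor_hom]) rfl ca
    cb (ca ≫ snd _ _) (by simp [← w', rightUnitor_hom]) rfl h₁ h₂ (by simp [← h₁])]
  simp only [Functor.map_comp, Category.assoc, rten]
  congr 1
  exact map_rightUnitor_tensor (re L c) _ _ _ _ (reC_unit _ _ _ _)

lemma tHom_id (x y : Total L) : tHom (𝟙 x) (𝟙 y) = 𝟙 (tobj x y) := by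
  refine total_hom_ext (𝟙 _) (by simp) rfl ?_
  rw [cpt_id, cpt_tHom (𝟙 x) (𝟙 y) (𝟙 _) (𝟙 _) (by simp) (fst _ _) (snd _ _) (fst _ _)
    (snd _ _) (by simp) (by simp) (by simp) (by simp) (by simp) (by simp), cpt_id, cpt_id]
  simp

lemma tHom_comp {x y z x' y' z' : Total L} (f : x ⟶ y) (f' : x' ⟶ y') (g : y ⟶ z)
    (g' : y' ⟶ z') : tHom f f' ≫ tHom g g' = tHom (f ≫ g) (f' ≫ g') := by
  refine total_hom_ext ((tbase f ⊗ₘ tbase f') ≫ (tbase g ⊗ₘ tbase g')) (by simp) (by simp) ?_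
  have e₁ := cpt_comp (tHom f f') (tHom g g') (𝟙 _) (tbase f ⊗ₘ tbase f')
    ((tbase f ⊗ₘ tbase f') ≫ (tbase g ⊗ₘ tbase g')) (by simp) (by simp) (by simp)
  have e₂ := cpt_tHom f f' (𝟙 _) (tbase f ⊗ₘ tbase f') (by simp) (fst _ _) (snd _ _)
    (fst _ _ ≫ tbase f)
    (snd _ _ ≫ tbase f') (by simp) (by simp) (by simp) (by simp) (by simp) (by simp)
  have e₃ := cpt_tHom g g' (tbase f ⊗ₘ tbase f') ((tbase f ⊗ₘ tbase f') ≫ (tbase g ⊗ₘ tbase g'))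
    (by simp) (fst _ _ ≫ tbase f) (snd _ _ ≫ tbase f') (fst _ _ ≫ tbase f ≫ tbase g)
    (snd _ _ ≫ tbase f' ≫ tbase g') (by simp) (by simp) (by simp) (by simp) (by simp) (by simp)
  have e₄ := cpt_tHom (f ≫ g) (f' ≫ g') (𝟙 _) ((tbase f ⊗ₘ tbase f') ≫ (tbase g ⊗ₘ tbase g'))
    (by simp) (fst _ _) (snd _ _) (fst _ _ ≫ tbase f ≫ tbase g)
    (snd _ _ ≫ tbase f' ≫ tbase g') (by simp) (by simp) (by simp) (by simp) (by simp) (by simp)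
  have e₅ := cpt_comp f g (fst x.base x'.base) (fst _ _ ≫ tbase f) (fst _ _ ≫ tbase f ≫ tbase g)
    (by simp) (by simp) (by simp)
  have e₆ := cpt_comp f' g' (snd x.base x'.base) (snd _ _ ≫ tbase f')
    (snd _ _ ≫ tbase f' ≫ tbase g') (by simp) (by simp) (by simp)
  refine e₁.trans ?_
  refine Eq.trans ?_ e₄.symm
  refine (congrArg₂ (· ≫ ·) e₂ e₃).trans ?_
  refine Eq.trans ?_ (congrArg₂ (fun s t => _ ≫ (s ⊗ₘ t) ≫ _) e₅ e₆).symm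
  simp

lemma cpt_tHomL {x x' y y' z z' : Total L} (f : x ⟶ x') (g : y ⟶ y') (h : z ⟶ z') {B : C}
    (a : B ⟶ (x.base ⊗ y.base) ⊗ z.base) (b : B ⟶ (x'.base ⊗ y'.base) ⊗ z'.base)
    (w : a ≫ tbase (tHom (tHom f g) h) = b) (a₁ : B ⟶ x.base ⊗ y.base)
    (b₁ : B ⟶ x'.base ⊗ y'.base) (p : B ⟶ x.base) (q : B ⟶ y.base) (r : B ⟶ z.base)
    (p' : B ⟶ x'.base) (q' : B ⟶ y'.base) (r' : B ⟶ z'.base) (h₁ : a ≫ fst _ _ = a₁)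
    (hp : a₁ ≫ fst _ _ = p) (hq : a₁ ≫ snd _ _ = q) (hr : a ≫ snd _ _ = r)
    (h₁' : b ≫ fst _ _ = b₁) (hp' : b₁ ≫ fst _ _ = p') (hq' : b₁ ≫ snd _ _ = q')
    (hr' : b ≫ snd _ _ = r') (wp : p ≫ tbase f = p') (wq : q ≫ tbase g = q')
    (wr : r ≫ tbase h = r') :
    cpt (tHom (tHom f g) h) a b w = (tensL x.fiber y.fiber z.fiber a a₁ p q r h₁ hp hq hr).hom ≫
      ((cpt f p p' wp ⊗ₘ cpt g q q' wq) ⊗ₘ cpt h r r' wr) ≫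
        (tensL x'.fiber y'.fiber z'.fiber b b₁ p' q' r' h₁' hp' hq' hr').inv := by
  have w₁ : a₁ ≫ tbase (tHom f g) = b₁ := by
    subst h₁ h₁'
    rw [← w, tbase_tHom, tbase_tHom, Category.assoc, Category.assoc, tensorHom_fst]
    rfl
  rw [cpt_tHom (tHom f g) h a b w a₁ r b₁ r' h₁ hr h₁' hr' w₁ wr,
    cpt_tHom f g a₁ b₁ w₁ p q p' q' hp hq hp' hq' wp wq]
  simp only [tensL, Iso.trans_hom, Iso.trans_inv, whiskerRightIso_hom, whiskerRightIso_inv,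
    Category.assoc, whiskerRight_comp_tensorHom_assoc, tensorHom_comp_whiskerRight_assoc]

lemma cpt_tHomR {x x' y y' z z' : Total L} (f : x ⟶ x') (g : y ⟶ y') (h : z ⟶ z') {B : C}
    (a : B ⟶ x.base ⊗ (y.base ⊗ z.base)) (b : B ⟶ x'.base ⊗ (y'.base ⊗ z'.base))
    (w : a ≫ tbase (tHom f (tHom g h)) = b) (a₂ : B ⟶ y.base ⊗ z.base)
    (b₂ : B ⟶ y'.base ⊗ z'.base) (p : B ⟶ x.base) (q : B ⟶ y.base) (r : B ⟶ z.base)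
    (p' : B ⟶ x'.base) (q' : B ⟶ y'.base) (r' : B ⟶ z'.base) (h₂ : a ≫ snd _ _ = a₂)
    (hp : a ≫ fst _ _ = p) (hq : a₂ ≫ fst _ _ = q) (hr : a₂ ≫ snd _ _ = r)
    (h₂' : b ≫ snd _ _ = b₂) (hp' : b ≫ fst _ _ = p') (hq' : b₂ ≫ fst _ _ = q')
    (hr' : b₂ ≫ snd _ _ = r') (wp : p ≫ tbase f = p') (wq : q ≫ tbase g = q')
    (wr : r ≫ tbase h = r') :
    cpt (tHom f (tHom g h)) a b w = (tensR x.fiber y.fiber z.fiber a a₂ p q r h₂ hp hq hr).hom ≫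
      (cpt f p p' wp ⊗ₘ (cpt g q q' wq ⊗ₘ cpt h r r' wr)) ≫
        (tensR x'.fiber y'.fiber z'.fiber b b₂ p' q' r' h₂' hp' hq' hr').inv := by
  have w₂ : a₂ ≫ tbase (tHom g h) = b₂ := by
    subst h₂ h₂'
    rw [← w]
    simp
  rw [cpt_tHom f (tHom g h) a b w p a₂ p' b₂ hp h₂ hp' h₂' wp w₂,
    cpt_tHom g h a₂ b₂ w₂ q r q' r' hq hr hq' hr' wq wr]
  simp only [tensR, Iso.trans_hom, Iso.trans_inv, whiskerLeftIso_hom, whiskerLeftIso_inv,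
    Category.assoc, whiskerLeft_comp_tensorHom_assoc, tensorHom_comp_whiskerLeft_assoc]

lemma tassoc_natural {x x' y y' z z' : Total L} (f : x ⟶ x') (g : y ⟶ y') (h : z ⟶ z') :
    tHom (tHom f g) h ≫ (tassoc x' y' z').hom = (tassoc x y z).hom ≫ tHom f (tHom g h) := by
  refine sq_ext ((tbase f ⊗ₘ tbase g) ⊗ₘ tbase h) (α_ _ _ _).hom
    (((tbase f ⊗ₘ tbase g) ⊗ₘ tbase h) ≫ (α_ _ _ _).hom) (by simp) (by simp) (by simp)
    (by simp) ?_
  have e₁ := cpt_tHomL f g h (𝟙 _) ((tbase f ⊗ₘ tbase g) ⊗ₘ tbase h) (by simp)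
      (fst _ _) (fst _ _ ≫ (tbase f ⊗ₘ tbase g)) (fst _ _ ≫ fst _ _) (fst _ _ ≫ snd _ _)
      (snd _ _) ((fst _ _ ≫ fst _ _) ≫ tbase f) ((fst _ _ ≫ snd _ _) ≫ tbase g)
      (snd _ _ ≫ tbase h) (by simp) (by simp) (by simp) (by simp) (tensorHom_fst _ _) (by simp)
      (by simp) (by simp) (by simp) (by simp) (by simp)
  have e₂ := cpt_assoc x' y' z' ((tbase f ⊗ₘ tbase g) ⊗ₘ tbase h)
      (((tbase f ⊗ₘ tbase g) ⊗ₘ tbase h) ≫ (α_ _ _ _).hom) (by simp)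
      (fst _ _ ≫ (tbase f ⊗ₘ tbase g)) (((tbase f ⊗ₘ tbase g) ⊗ₘ tbase h) ≫
        (α_ _ _ _).hom ≫ snd _ _) ((fst _ _ ≫ fst _ _) ≫ tbase f) ((fst _ _ ≫ snd _ _) ≫ tbase g)
      (snd _ _ ≫ tbase h) (tensorHom_fst _ _) (by simp) (by simp) (by simp) (by simp) (by simp)
      (by simp) (by simp)
  have e₃ := cpt_assoc x y z (𝟙 _) (α_ _ _ _).hom (by simp) (fst _ _)
      ((α_ _ _ _).hom ≫ snd _ _) (fst _ _ ≫ fst _ _) (fst _ _ ≫ snd _ _)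
      (snd _ _) (by simp) (by simp) (by simp) (by simp) (by simp) (by simp) (by simp) (by simp)
  have e₄ := cpt_tHomR f g h (α_ _ _ _).hom (((tbase f ⊗ₘ tbase g) ⊗ₘ tbase h) ≫ (α_ _ _ _).hom)
      (by simp) ((α_ _ _ _).hom ≫ snd _ _)
      (((tbase f ⊗ₘ tbase g) ⊗ₘ tbase h) ≫ (α_ _ _ _).hom ≫ snd _ _)
      (fst _ _ ≫ fst _ _) (fst _ _ ≫ snd _ _)
      (snd _ _) ((fst _ _ ≫ fst _ _) ≫ tbase f) ((fst _ _ ≫ snd _ _) ≫ tbase g)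
      (snd _ _ ≫ tbase h) (by simp) (by simp) (by simp) (by simp) (by simp) (by simp) (by simp)
      (by simp) (by simp) (by simp) (by simp)
  refine (congrArg₂ (· ≫ ·) e₁ e₂).trans (Eq.trans ?_ (congrArg₂ (· ≫ ·) e₃ e₄).symm)
  simp

lemma tlunit_natural {x y : Total L} (f : x ⟶ y) :
    tHom (𝟙 (tunit L)) f ≫ (tlunit y).hom = (tlunit x).hom ≫ f := by
  refine sq_ext (𝟙 _ ⊗ₘ tbase f) (snd _ _) (snd _ _ ≫ tbase f) (by simp)
    (by simp [leftUnitor_hom]) (by simp [leftUnitor_hom]) (by simp) ?_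
  have e₁ := cpt_tHom (𝟙 (tunit L)) f (𝟙 _) (𝟙 _ ⊗ₘ tbase f) (by simp) (fst _ _) (snd _ _)
    (fst _ _) (snd _ _ ≫ tbase f) (by simp) (by simp)
    ((tensorHom_fst _ _).trans (Category.comp_id _)) (tensorHom_snd _ _) (by simp) (by simp)
  have e₂ := cpt_lunit y (𝟙 _ ⊗ₘ tbase f) (snd _ x.base ≫ tbase f) (by simp [leftUnitor_hom])
    (fst _ _) ((tensorHom_fst _ _).trans (Category.comp_id _)) (tensorHom_snd _ _)
  have e₃ := cpt_lunit x (𝟙 _) (snd _ _) (by simp [leftUnitor_hom]) (fst _ _) (by simp) (by simp)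
  rw [cpt_id] at e₁
  refine (congrArg₂ (· ≫ ·) e₁ e₂).trans (Eq.trans ?_ (congrArg (· ≫ cpt f _ _ _) e₃).symm)
  simp [-Functor.LaxMonoidal.left_unitality, -Functor.LaxMonoidal.right_unitality]
  rw [whisker_exchange_assoc, leftUnitor_naturality]

lemma trunit_natural {x y : Total L} (f : x ⟶ y) :
    tHom f (𝟙 (tunit L)) ≫ (trunit y).hom = (trunit x).hom ≫ f := by
  refine sq_ext (tbase f ⊗ₘ 𝟙 _) (fst _ _) (fst _ _ ≫ tbase f) (by simp)
    (by simp [rightUnitor_hom]) (by simp [rightUnitor_hom]) (by simp) ?_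
  have e₁ := cpt_tHom f (𝟙 (tunit L)) (𝟙 _) (tbase f ⊗ₘ 𝟙 _) (by simp) (fst _ _) (snd _ _)
    (fst _ _ ≫ tbase f) (snd _ _) (by simp) (by simp) (tensorHom_fst _ _)
    ((tensorHom_snd _ _).trans (Category.comp_id _)) (by simp) (by simp)
  have e₂ := cpt_runit y (tbase f ⊗ₘ 𝟙 _) (fst x.base _ ≫ tbase f) (by simp [rightUnitor_hom])
    (snd _ _) (tensorHom_fst _ _) ((tensorHom_snd _ _).trans (Category.comp_id _))
  have e₃ := cpt_runit x (𝟙 _) (fst _ _) (by simp [rightUnitor_hom]) (snd _ _) (by simp) (by simp)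
  rw [cpt_id] at e₁
  refine (congrArg₂ (· ≫ ·) e₁ e₂).trans (Eq.trans ?_ (congrArg (· ≫ cpt f _ _ _) e₃).symm)
  simp [-Functor.LaxMonoidal.left_unitality, -Functor.LaxMonoidal.right_unitality]
  rw [← whisker_exchange_assoc, rightUnitor_naturality]

lemma ttriangle (x y : Total L) :
    (tassoc x (tunit L) y).hom ≫ tHom (𝟙 x) (tlunit y).hom = tHom (trunit x).hom (𝟙 y) := by
  have t : (α_ x.base (𝟙_ C) y.base).hom ≫ x.base ◁ snd (𝟙_ C) y.base =
      fst x.base (𝟙_ C) ▷ y.base := by ext <;> simp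
  refine total_hom_ext (fst _ _ ▷ _) (by simp [leftUnitor_hom, t]) (by simp [rightUnitor_hom]) ?_
  have e₀ := cpt_comp (tassoc x (tunit L) y).hom (tHom (𝟙 x) (tlunit y).hom) (𝟙 _) (α_ _ _ _).hom
    (fst _ _ ▷ _) (by simp) (by simp [leftUnitor_hom, t]) (by simp [leftUnitor_hom, t])
  have e₁ := cpt_assoc x (tunit L) y (𝟙 _) (α_ _ _ _).hom (by simp) (fst _ _)
      ((α_ _ _ _).hom ≫ snd _ _) (fst _ _ ≫ fst _ _) (fst _ _ ≫ snd _ _)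
      (snd _ _) (by simp) (by simp) (by simp) (by simp) (by simp) (by simp) (by simp) (by simp)
  have e₂ := cpt_tHom (𝟙 x) (tlunit y).hom (α_ x.base (𝟙_ C) y.base).hom (fst _ _ ▷ _)
    (by simp [leftUnitor_hom, t]) (fst _ _ ≫ fst _ _) ((α_ _ _ _).hom ≫ snd _ _) (fst _ _ ≫ fst _ _)
    (snd _ _) (by simp) (by simp) (by simp) (by simp) (by simp) (by simp [leftUnitor_hom])
  have e₃ := cpt_lunit y ((α_ x.base (𝟙_ C) y.base).hom ≫ snd _ _) (snd _ _)
    (by simp [leftUnitor_hom]) (fst _ _ ≫ snd _ _) (by simp) (by simp)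
  have e₄ := cpt_tHom (trunit x).hom (𝟙 y) (𝟙 _) (fst _ _ ▷ _)
    (by simp [rightUnitor_hom]) (fst _ _) (snd _ _) (fst _ _ ≫ fst _ _)
    (snd _ _) (by simp) (by simp) (by simp) (by simp) (by simp [rightUnitor_hom]) (by simp)
  have e₅ := cpt_runit x (fst (x.base ⊗ 𝟙_ C) y.base) (fst _ _ ≫ fst _ _)
    (by simp [rightUnitor_hom]) (fst _ _ ≫ snd _ _) (by simp) (by simp)
  rw [cpt_id] at e₂ e₄
  rw [e₃] at e₂
  rw [e₅] at e₄
  refine (e₀.trans (congrArg₂ (· ≫ ·) e₁ e₂)).trans (Eq.trans ?_ e₄.symm)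
  simp [tensL, tensR, -Functor.LaxMonoidal.left_unitality, -Functor.LaxMonoidal.right_unitality]

lemma pentagon_fib {W X Y Z B : C} (w : fib L W) (x : fib L X) (y : fib L Y) (z : fib L Z)
    (a : B ⟶ ((W ⊗ X) ⊗ Y) ⊗ Z) (b₁ : B ⟶ (W ⊗ (X ⊗ Y)) ⊗ Z) (b₂ : B ⟶ W ⊗ ((X ⊗ Y) ⊗ Z))
    (b₃ : B ⟶ W ⊗ (X ⊗ (Y ⊗ Z))) (d : B ⟶ (W ⊗ X) ⊗ (Y ⊗ Z)) (p : B ⟶ W) (q : B ⟶ X)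
    (r : B ⟶ Y) (s : B ⟶ Z) (pq : B ⟶ W ⊗ X) (qr : B ⟶ X ⊗ Y) (rs : B ⟶ Y ⊗ Z)
    (pqr : B ⟶ (W ⊗ X) ⊗ Y) (pqr' : B ⟶ W ⊗ (X ⊗ Y)) (qrs : B ⟶ (X ⊗ Y) ⊗ Z)
    (qrs' : B ⟶ X ⊗ (Y ⊗ Z)) (h₁ h₂ h₃ h₄ h₅ h₆ h₇ h₈ h₉ h₁₀ h₁₁ h₁₂ h₁₃ h₁₄ h₁₅ h₁₆ h₁₇ h₁₈ h₁₉
      h₂₀ h₂₁ h₂₂ h₂₃ h₂₄) :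
    ((tens ((re L (fst _ _)).obj ((re L (fst _ _)).obj w ⊗ (re L (snd _ _)).obj x) ⊗
        (re L (snd _ _)).obj y) z a pqr s h₁ h₂).hom ≫
      (((tensL w x y pqr pq p q r h₃ h₄ h₅ h₆).hom ≫ (α_ _ _ _).hom ≫
        (tensR w x y pqr' qr p q r h₇ h₈ h₉ h₁₀).inv) ⊗ₘ 𝟙 _) ≫
      (tens _ z b₁ pqr' s h₁₁ h₁₂).inv) ≫
    ((tensL w ((re L (fst _ _)).obj x ⊗ (re L (snd _ _)).obj y) z b₁ pqr' p qr s
        h₁₁ h₈ h₇ h₁₂).hom ≫ (α_ _ _ _).hom ≫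
      (tensR w _ z b₂ qrs p qr s h₁₃ h₁₄ h₁₅ h₁₆).inv) ≫
    ((tens w _ b₂ p qrs h₁₄ h₁₃).hom ≫
      (𝟙 _ ⊗ₘ ((tensL x y z qrs qr q r s h₁₅ h₉ h₁₀ h₁₆).hom ≫ (α_ _ _ _).hom ≫
        (tensR x y z qrs' rs q r s h₁₇ h₁₈ h₁₉ h₂₀).inv)) ≫
      (tens w _ b₃ p qrs' h₂₁ h₂₂).inv) =
    ((tensL _ y z a pqr pq r s h₁ h₃ h₆ h₂).hom ≫ (α_ _ _ _).hom ≫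
      (tensR ((re L (fst _ _)).obj w ⊗ (re L (snd _ _)).obj x) y z d rs pq r s
        h₂₃ h₂₄ h₁₉ h₂₀).inv) ≫
    ((tensL w x _ d pq p q rs h₂₄ h₄ h₅ h₂₃).hom ≫ (α_ _ _ _).hom ≫
      (tensR w x _ b₃ qrs' p q rs h₂₂ h₂₁ h₁₈ h₁₇).inv) := by
  simp [tensL, tensR]
  rw [whisker_exchange_assoc]
  simp

lemma tpentagon (w x y z : Total L) :
    tHom (tassoc w x y).hom (𝟙 z) ≫ (tassoc w (tobj x y) z).hom ≫ tHom (𝟙 w) (tassoc x y z).hom =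
      (tassoc (tobj w x) y z).hom ≫ (tassoc w x (tobj y z)).hom := by
  let b₁ := (α_ w.base x.base y.base).hom ▷ z.base
  let b₂ := b₁ ≫ (α_ w.base (x.base ⊗ y.base) z.base).hom
  let d := (α_ (w.base ⊗ x.base) y.base z.base).hom
  let b₃ := d ≫ (α_ w.base x.base (y.base ⊗ z.base)).hom
  have hb : b₂ ≫ w.base ◁ (α_ x.base y.base z.base).hom = b₃ := by simp [b₃, b₂, d, b₁]
  let pqr := fst ((w.base ⊗ x.base) ⊗ y.base) z.base
  let pq := pqr ≫ fst _ _
  let p := pq ≫ fst _ _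
  let q := pq ≫ snd _ _
  let r := pqr ≫ snd _ _
  let s := snd ((w.base ⊗ x.base) ⊗ y.base) z.base
  let pqr' := pqr ≫ (α_ w.base x.base y.base).hom
  let qr := pqr' ≫ snd _ _
  let qrs := b₂ ≫ snd _ _
  let qrs' := b₃ ≫ snd _ _
  let rs := d ≫ snd _ _
  have e₁ := cpt_tHom (tassoc w x y).hom (𝟙 z) (𝟙 _) b₁ (by simp [b₁]) pqr s pqr' s
    (Category.id_comp _) (Category.id_comp _) (by simp [b₁, pqr', pqr]) (by simp [b₁, s]) rfl
    (Category.comp_id _)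
  have e₁' := cpt_assoc w x y pqr pqr' rfl pq qr p q r rfl rfl rfl rfl rfl
    (by simp [pqr', p, pq]) (by simp [qr, pqr', q, pq]) (by simp [qr, pqr', r])
  have e₂ := cpt_assoc w (tobj x y) z b₁ b₂ rfl pqr' qrs p qr s (by simp [b₁, pqr', pqr])
    (by simp [pqr', p, pq]) rfl (by simp [b₁, s]) rfl (by simp [b₂, b₁, p, pq, pqr])
    (by simp [qrs, b₂, b₁, qr, pqr', pqr]) (by simp [qrs, b₂, b₁, s])
  have e₃ := cpt_tHom (𝟙 w) (tassoc x y z).hom b₂ b₃ (by simp [hb]) p qrs p qrs'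
    (by simp [b₂, b₁, p, pq, pqr]) rfl (by simp [b₃, d, p, pq, pqr]) rfl
    (Category.comp_id _) (by simp [qrs, qrs', ← hb])
  have e₃' := cpt_assoc x y z qrs qrs' (by simp [qrs, qrs', ← hb]) qr rs q r s
    (by simp [qrs, b₂, b₁, qr, pqr', pqr]) (by simp [qr, pqr', q, pq]) (by simp [qr, pqr', r])
    (by simp [qrs, b₂, b₁, s]) (by simp [qrs', b₃, d, rs]) (by simp [qrs', b₃, d, q, pq, pqr])
    (by simp [rs, d, r, pqr]) (by simp [rs, d, s])
  have e₄ := cpt_assoc (tobj w x) y z (𝟙 _) d (Category.id_comp _) pqr rs pq r s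
    (Category.id_comp _) rfl rfl (Category.id_comp _) rfl (by simp [d, pq, pqr])
    (by simp [rs, d, r, pqr]) (by simp [rs, d, s])
  have e₅ := cpt_assoc w x (tobj y z) d b₃ rfl pq qrs' p q rs (by simp [d, pq, pqr]) rfl rfl rfl
    rfl (by simp [b₃, d, p, pq, pqr]) (by simp [qrs', b₃, d, q, pq, pqr])
    (by simp [qrs', b₃, d, rs])
  have e₁ := e₁.trans (congrArg₂ (fun t t' => _ ≫ (t ⊗ₘ t') ≫ _) e₁' (cpt_id z s _))
  have e₃ := e₃.trans (congrArg₂ (fun t t' => _ ≫ (t ⊗ₘ t') ≫ _) (cpt_id w p _) e₃')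
  rw [← Category.assoc]
  refine sq_ext b₂ d b₃ (by simp [b₂, b₁]) (by simp [hb]) rfl rfl ?_
  have e₀ := cpt_comp (tHom (tassoc w x y).hom (𝟙 z)) (tassoc w (tobj x y) z).hom (𝟙 _) b₁ b₂
    (by simp [b₁]) rfl (by simp [b₂, b₁])
  refine (congrArg₂ (· ≫ ·) (e₀.trans (congrArg₂ (· ≫ ·) e₁ e₂)) e₃).trans ?_
  refine Eq.trans ?_ (congrArg₂ (· ≫ ·) e₄ e₅).symm
  exact (Category.assoc _ _ _).trans (pentagon_fib w.fiber x.fiber y.fiber z.fiber (𝟙 _) b₁ b₂ b₃ d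
    p q r s pq qr rs pqr pqr' qrs qrs' _ _ _ _ _ _ _ _ _ _ _ _ _ _ _ _ _ _ _ _ _ _ _ _)

end Monoidal

section

variable {C : Type u} [Category.{v} C] [CartesianMonoidalCategory C]
  (L : IndexedCat.{v, u, v', u'} C) [IndexedMonoidal L]

/-- The fibred monoidal structure on `Σ_C L`:
`(X, x) ⊗ (Y, y) = (X × Y, π₁^* x ⊗ π₂^* y)` with unit `(1, I)`. -/
instance totalMonoidal : MonoidalCategory (Total L) :=
  letI : MonoidalCategoryStruct (Total L) :=
    { tensorObj := tobj
      whiskerLeft x _ _ f := tHom (𝟙 x) f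
      whiskerRight f y := tHom f (𝟙 y)
      tensorHom f g := tHom f g
      tensorUnit := tunit L
      associator := tassoc
      leftUnitor := tlunit
      rightUnitor := trunit }
  MonoidalCategory.ofTensorHom (C := Total L)
    (id_tensorHom_id := tHom_id)
    (id_tensorHom := fun _ _ _ _ => rfl)
    (tensorHom_id := fun _ _ => rfl)
    (tensorHom_comp_tensorHom := tHom_comp)
    (associator_naturality := tassoc_natural)
    (leftUnitor_naturality := tlunit_natural)
    (rightUnitor_naturality := trunit_natural)
    (pentagon := tpentagon)
    (triangle := ttriangle)

end

open CartesianMonoidalCategory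

section Models

variable {C : Type u} [Category.{v} C]

/-- The isomorphism `t^* r^* ≅ l^* b^*` given by a commutative square. -/
def reSquare (L : IndexedCat.{v, u, v₁, u₁} C) {A B E F : C} (t : A ⟶ B) (l : A ⟶ E) (r : B ⟶ F)
    (b : E ⟶ F) (w : t ≫ r = l ≫ b) : re L r ⋙ re L t ≅ re L b ⋙ re L l :=
  reComp L t r (t ≫ r) rfl ≪≫ (reComp L l b (t ≫ r) w.symm).symm

/-- Indexed terminal objects: terminal objects in the fibres, preserved by reindexing. -/
structure IndexedTerminal (D : IndexedCat.{v, u, v₁, u₁} C) where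
  one (W : C) : fib D W
  isTerminal (W : C) : Limits.IsTerminal (one W)
  reIsTerminal {W' W : C} (f : W' ⟶ W) : Limits.IsTerminal ((re D f).obj (one W))

namespace IndexedTerminal

variable {D : IndexedCat.{v, u, v₁, u₁} C} (T : IndexedTerminal D)

/-- Two morphisms of `Σ_C D` into a terminal object of a fibre agree if their bases agree. -/
lemma hom_ext {x : Total D} {W : C} {Φ Ψ : x ⟶ (⟨W, T.one W⟩ : Total D)}
    (h : tbase Φ = tbase Ψ) : Φ = Ψ := by
  obtain ⟨f, φ⟩ := Φ
  obtain ⟨g, ψ⟩ := Ψ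
  change f = g at h
  subst h
  exact congrArg (Pseudofunctor.CoGrothendieck.Hom.mk f) ((T.reIsTerminal f).hom_ext φ ψ)

/-- The section `1 : C ⥤ Σ_C D` of the projection. -/
def unitSection : C ⥤ Total D where
  obj W := ⟨W, T.one W⟩
  map {W W'} f := tmk (x := ⟨W, T.one W⟩) (y := ⟨W', T.one W'⟩) f ((T.reIsTerminal f).from _)
  map_id _ := T.hom_ext rfl
  map_comp _ _ := T.hom_ext rfl

/-- The section `1` is right adjoint to the projection. -/
def forgetAdj : Pseudofunctor.CoGrothendieck.forget D ⊣ T.unitSection :=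
  Adjunction.mkOfHomEquiv
    { homEquiv x W :=
        { toFun f := tmk (x := x) (y := ⟨W, T.one W⟩) f ((T.reIsTerminal f).from _)
          invFun Φ := tbase Φ
          left_inv _ := rfl
          right_inv _ := T.hom_ext rfl }
      homEquiv_naturality_left_symm _ _ := rfl
      homEquiv_naturality_right _ _ := T.hom_ext rfl }

end IndexedTerminal

/-- Comprehension: a right adjoint `(W, w) ↦ W.w` of `1 : C ⥤ Σ_C D`. -/
structure Comprehension {D : IndexedCat.{v, u, v₁, u₁} C} (T : IndexedTerminal D) where
  ext : Total D ⥤ C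
  adj : T.unitSection ⊣ ext

namespace Comprehension

variable {D : IndexedCat.{v, u, v₁, u₁} C} {T : IndexedTerminal D} (K : Comprehension T)

/-- The object `W.w`. -/
abbrev ctx (W : C) (w : fib D W) : C := K.ext.obj ⟨W, w⟩

/-- The counit `(W.w, 1) ⟶ (W, w)`. -/
def counit (W : C) (w : fib D W) : (⟨K.ctx W w, T.one _⟩ : Total D) ⟶ ⟨W, w⟩ :=
  K.adj.counit.app ⟨W, w⟩

/-- The projection `p : W.w ⟶ W`. -/
def p (W : C) (w : fib D W) : K.ctx W w ⟶ W := tbase (K.counit W w)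

/-- The generic element `1 ⟶ p^* w` over `W.w`. -/
def gen (W : C) (w : fib D W) : T.one (K.ctx W w) ⟶ (re D (K.p W w)).obj w :=
  tfib (K.counit W w)

/-- The morphism `q : W'.f^*w ⟶ W.w` over `f`. -/
def q {W' W : C} (f : W' ⟶ W) (w : fib D W) : K.ctx W' ((re D f).obj w) ⟶ K.ctx W w :=
  K.ext.map (tmk (x := ⟨W', (re D f).obj w⟩) (y := ⟨W, w⟩) f (𝟙 _))

lemma ext_map_p {x y : Total D} (Φ : x ⟶ y) :
    K.ext.map Φ ≫ K.p y.base y.fiber = K.p x.base x.fiber ≫ tbase Φ :=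
  congrArg tbase (K.adj.counit.naturality Φ)

lemma q_p {W' W : C} (f : W' ⟶ W) (w : fib D W) :
    K.q f w ≫ K.p W w = K.p W' ((re D f).obj w) ≫ f :=
  K.ext_map_p (tmk (x := ⟨W', (re D f).obj w⟩) (y := ⟨W, w⟩) f (𝟙 _))

end Comprehension

/-- Strong `Σ`-types: left adjoints of reindexing along the projections `p`, with the left
Beck–Chevalley condition, such that the canonical map `W.w.w' ⟶ W.Σ_w w'` is invertible. -/
structure StrongSigma {D : IndexedCat.{v, u, v₁, u₁} C} {T : IndexedTerminal D}
    (K : Comprehension T) where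
  sigma {W : C} (w : fib D W) : fib D (K.ctx W w) ⥤ fib D W
  adj {W : C} (w : fib D W) : sigma w ⊣ re D (K.p W w)
  beckChevalley {W' W : C} (f : W' ⟶ W) (w : fib D W) :
    IsIso ((mateEquiv (G := re D (K.q f w)) (H := re D f) (adj w) (adj ((re D f).obj w))).symm
      (TwoSquare.mk _ _ _ _ (reSquare D (K.q f w) (K.p W' ((re D f).obj w)) (K.p W w) f
        (K.q_p f w)).hom)).natTrans
  isIso_pair {W : C} (w : fib D W) (w' : fib D (K.ctx W w)) :
    IsIso (K.ext.map (tmk (x := ⟨K.ctx W w, w'⟩) (y := ⟨W, (sigma w).obj w'⟩) (K.p W w)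
      ((adj w).unit.app w')))

/-- `Π`-types: right adjoints of reindexing along the projections `p`, with the right
Beck–Chevalley condition. -/
structure PiTypes {D : IndexedCat.{v, u, v₁, u₁} C} {T : IndexedTerminal D}
    (K : Comprehension T) where
  pi {W : C} (w : fib D W) : fib D (K.ctx W w) ⥤ fib D W
  adj {W : C} (w : fib D W) : re D (K.p W w) ⊣ pi w
  beckChevalley {W' W : C} (f : W' ⟶ W) (w : fib D W) :
    IsIso (mateEquiv (G := re D f) (H := re D (K.q f w)) (adj w) (adj ((re D f).obj w))
      (TwoSquare.mk _ _ _ _ (reSquare D (K.p W' ((re D f).obj w)) (K.q f w) f (K.p W w)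
        (K.q_p f w).symm).hom)).natTrans

/-- The isomorphism `W.w.w' ≅ W.Σ_w w'`. -/
noncomputable def StrongSigma.pair {D : IndexedCat.{v, u, v₁, u₁} C} {T : IndexedTerminal D}
    {K : Comprehension T} (S : StrongSigma K) {W : C} (w : fib D W) (w' : fib D (K.ctx W w)) :
    K.ctx (K.ctx W w) w' ≅ K.ctx W ((S.sigma w).obj w') :=
  have := S.isIso_pair w w'
  asIso (K.ext.map (tmk (x := ⟨K.ctx W w, w'⟩) (y := ⟨W, (S.sigma w).obj w'⟩) (K.p W w)
      ((S.adj w).unit.app w')))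

variable [CartesianMonoidalCategory C]

/-- Every object `X` of the base is represented by a closed type: `1.code X ≅ X`. -/
structure Democracy {D : IndexedCat.{v, u, v₁, u₁} C} {T : IndexedTerminal D}
    (K : Comprehension T) where
  code : C → fib D (𝟙_ C)
  iso (X : C) : K.ctx (𝟙_ C) (code X) ≅ X

/-- Non-dependent `Π`-types: right adjoints of reindexing along the product projections
`W × X ⟶ W`, with the right Beck–Chevalley condition. -/
structure ProjectionPi (L : IndexedCat.{v, u, v₂, u₂} C) where
  pi (W X : C) : fib L (W ⊗ X) ⥤ fib L W
  adj (W X : C) : re L (fst W X) ⊣ pi W X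
  beckChevalley {W' W : C} (f : W' ⟶ W) (X : C) :
    IsIso (mateEquiv (G := re L f) (H := re L (f ▷ X)) (adj W X) (adj W' X)
      (TwoSquare.mk _ _ _ _ (reSquare L (fst W' X) (f ▷ X) f (fst W X)
        (whiskerRight_fst f X).symm).hom)).natTrans

end Models

section Cotractable

variable {C : Type u} [Category.{v} C]

open scoped Prod

/-- A binary operation on the fibres of `L`, compatible with reindexing. -/
structure FibreTensor (L : IndexedCat.{v, u, v₂, u₂} C) where
  tensor (W : C) : fib L W ⥤ fib L W ⥤ fib L W
  comparison {W' W : C} (f : W' ⟶ W) (b c : fib L W) :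
    ((tensor W').obj ((re L f).obj b)).obj ((re L f).obj c) ≅
      (re L f).obj (((tensor W).obj b).obj c)

/-- The tensor product `b ⊗ c` of an indexed monoidal structure. -/
def FibreTensor.standard (L : IndexedCat.{v, u, v₂, u₂} C) [IndexedMonoidal L] :
    FibreTensor L where
  tensor W := curriedTensor (fib L W)
  comparison f b c := Functor.Monoidal.μIso (re L f) b c

/-- The reversed tensor product `c ⊗ b` of an indexed monoidal structure. -/
def FibreTensor.reversed (L : IndexedCat.{v, u, v₂, u₂} C) [IndexedMonoidal L] :
    FibreTensor L where
  tensor W := (curriedTensor (fib L W)).flip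
  comparison f b c := Functor.Monoidal.μIso (re L f) c b

/-- An indexed functor `L^op × L ⟶ D`, written `(b, a) ↦ T b ⊸ a`. -/
structure IndexedHom (L : IndexedCat.{v, u, v₂, u₂} C) (D : IndexedCat.{v, u, v₁, u₁} C) where
  hom (W : C) : (fib L W)ᵒᵖ × fib L W ⥤ fib D W
  homRe {W' W : C} (f : W' ⟶ W) :
    (re L f).op.prod (re L f) ⋙ hom W' ≅ hom W ⋙ re D f
  homRe_id {W : C} (b a : fib L W) :
    (homRe (𝟙 W)).hom.app (op b, a) ≫ (reI D ((hom W).obj (op b, a))).hom =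
      (hom W).map ((reI L b).inv.op ×ₘ (reI L a).hom)
  homRe_comp {W'' W' W : C} (f : W'' ⟶ W') (g : W' ⟶ W) (h : W'' ⟶ W) (w : f ≫ g = h)
    (b a : fib L W) :
    (homRe f).hom.app (op ((re L g).obj b), (re L g).obj a) ≫
        (re D f).map ((homRe g).hom.app (op b, a)) ≫
        (reC D f g h w ((hom W).obj (op b, a))).hom =
      (hom W'').map ((reC L f g h w b).inv.op ×ₘ (reC L f g h w a).hom) ≫
        (homRe h).hom.app (op b, a)

namespace IndexedHom

variable {L : IndexedCat.{v, u, v₂, u₂} C} {D : IndexedCat.{v, u, v₁, u₁} C}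
  (T : IndexedTerminal D) (H : IndexedHom L D)

/-- The comma category `1 ↓ (T(-) ⊸ (-))` over `W`, whose objects are triples `(b, a, g)` with
`g : 1 ⟶ T b ⊸ a`. -/
abbrev Elem (W : C) := StructuredArrow (T.one W) (H.hom W)

/-- The object `(b, a, g)` of the comma category. -/
abbrev elem {W : C} {b a : fib L W} (g : T.one W ⟶ (H.hom W).obj (op b, a)) : H.Elem T W :=
  StructuredArrow.mk (Y := ((op b, a) : (fib L W)ᵒᵖ × fib L W)) g

/-- Reindexing on the comma categories. -/
def elemRe {W' W : C} (f : W' ⟶ W) : H.Elem T W ⥤ H.Elem T W' :=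
  StructuredArrow.map₂ (F := (re L f).op.prod (re L f)) (G := re D f)
    ((T.reIsTerminal f).from (T.one W')) (H.homRe f).inv

/-- The isomorphism `T(f^* b) ⊸ f^* a ≅ f^*(T b ⊸ a)`. -/
def homReIso {W' W : C} (f : W' ⟶ W) (b a : fib L W) :
    (H.hom W').obj (op ((re L f).obj b), (re L f).obj a) ≅
      (re D f).obj ((H.hom W).obj (op b, a)) :=
  (H.homRe f).app (op b, a)

lemma elemReId_w {W : C} {b a : fib L W} (g : T.one W ⟶ (H.hom W).obj (op b, a)) :
    ((T.reIsTerminal (𝟙 W)).from (T.one W) ≫ (re D (𝟙 W)).map g ≫ (H.homReIso (𝟙 W) b a).inv) ≫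
      (H.hom W).map ((reI L b).inv.op ×ₘ (reI L a).hom) = g := by
  have h : (H.homReIso (𝟙 W) b a).hom ≫ (reI D ((H.hom W).obj (op b, a))).hom = _ :=
    H.homRe_id b a
  rw [← h, Category.assoc, Category.assoc, Iso.inv_hom_id_assoc, reI_natural, ← Category.assoc,
    (T.isTerminal W).hom_ext (_ ≫ (reI D (T.one W)).hom) (𝟙 _), Category.id_comp]

lemma elemReComp_w {W'' W' W : C} (f : W'' ⟶ W') (g : W' ⟶ W) (h : W'' ⟶ W) (w : f ≫ g = h)
    {b a : fib L W} (t : T.one W ⟶ (H.hom W).obj (op b, a)) :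
    ((T.reIsTerminal f).from (T.one W'') ≫ (re D f).map
      ((T.reIsTerminal g).from (T.one W') ≫ (re D g).map t ≫ (H.homReIso g b a).inv) ≫
      (H.homReIso f ((re L g).obj b) ((re L g).obj a)).inv) ≫
        (H.hom W'').map ((reC L f g h w b).inv.op ×ₘ (reC L f g h w a).hom) =
      (T.reIsTerminal h).from (T.one W'') ≫ (re D h).map t ≫ (H.homReIso h b a).inv := by
  have e : (H.homReIso f ((re L g).obj b) ((re L g).obj a)).hom ≫
      (re D f).map (H.homReIso g b a).hom ≫ (reC D f g h w ((H.hom W).obj (op b, a))).hom =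
        _ ≫ (H.homReIso h b a).hom := H.homRe_comp f g h w b a
  rw [← cancel_mono (H.homReIso h b a).hom]
  simp only [Category.assoc, Iso.inv_hom_id, Category.comp_id, Functor.map_comp]
  rw [← e, Iso.inv_hom_id_assoc, ← Functor.map_comp_assoc (re D f) (Iso.inv _), Iso.inv_hom_id,
    CategoryTheory.Functor.map_id, Category.id_comp, reC_natural]
  simp only [← Category.assoc]
  congr 1
  exact (T.reIsTerminal h).hom_ext _ _

/-- The comparison `𝟙^* m ⟶ m`. -/
def elemReId {W : C} (m : H.Elem T W) : (H.elemRe T (𝟙 W)).obj m ⟶ m :=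
  StructuredArrow.homMk ((reI L m.right.1.unop).inv.op ×ₘ (reI L m.right.2).hom)
    (H.elemReId_w T m.hom)

/-- The comparison `f^* g^* m ⟶ h^* m` for `h = f ≫ g`. -/
def elemReComp {W'' W' W : C} (f : W'' ⟶ W') (g : W' ⟶ W) (h : W'' ⟶ W) (w : f ≫ g = h)
    (m : H.Elem T W) :
    (H.elemRe T f).obj ((H.elemRe T g).obj m) ⟶ (H.elemRe T h).obj m :=
  StructuredArrow.homMk ((reC L f g h w m.right.1.unop).inv.op ×ₘ (reC L f g h w m.right.2).hom)
    (H.elemReComp_w T f g h w m.hom)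

end IndexedHom

/-- An indexed `Σ,D`-cotractable structure on the operation `K`: indexed functors
`hom = T(-) ⊸ (-) : L^op × L ⟶ D` and `resid = ∂ : 1 ↓ hom ⟶ L`, together with isomorphisms
`L(W)(b ⊗ c, a) ≅ Σ_{g : 1 ⟶ T b ⊸ a} L(W)(c, ∂(b, a, g))`, natural in `a, b, c` and compatible
with reindexing. -/
structure Cotractable {L : IndexedCat.{v, u, v₂, u₂} C} {D : IndexedCat.{v, u, v₁, u₁} C}
    (T : IndexedTerminal D) (K : FibreTensor L) extends H : IndexedHom L D where
  resid (W : C) : H.Elem T W ⥤ fib L W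
  residRe {W' W : C} (f : W' ⟶ W) : H.elemRe T f ⋙ resid W' ≅ resid W ⋙ re L f
  residRe_id {W : C} (m : H.Elem T W) :
    (residRe (𝟙 W)).hom.app m ≫ (reI L ((resid W).obj m)).hom = (resid W).map (H.elemReId T m)
  residRe_comp {W'' W' W : C} (f : W'' ⟶ W') (g : W' ⟶ W) (h : W'' ⟶ W) (w : f ≫ g = h)
    (m : H.Elem T W) :
    (residRe f).hom.app ((H.elemRe T g).obj m) ≫ (re L f).map ((residRe g).hom.app m) ≫
        (reC L f g h w ((resid W).obj m)).hom =
      (resid W'').map (H.elemReComp T f g h w m) ≫ (residRe h).hom.app m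
  homEquiv {W : C} (b c a : fib L W) :
    (((K.tensor W).obj b).obj c ⟶ a) ≃
      Σ g : T.one W ⟶ (H.hom W).obj (op b, a), (c ⟶ (resid W).obj (H.elem T g))
  homEquiv_natural {W : C} {b b' c c' a a' : fib L W} (β : b' ⟶ b) (γ : c' ⟶ c) (α : a ⟶ a')
    (φ : ((K.tensor W).obj b).obj c ⟶ a) :
    homEquiv b' c' a' (((K.tensor W).map β).app c' ≫ ((K.tensor W).obj b).map γ ≫ φ ≫ α) =
      ⟨(homEquiv b c a φ).1 ≫ (H.hom W).map (β.op ×ₘ α),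
        γ ≫ (homEquiv b c a φ).2 ≫ (resid W).map (StructuredArrow.homMk (β.op ×ₘ α) rfl)⟩
  homEquiv_re {W' W : C} (f : W' ⟶ W) {b c a : fib L W}
    (φ : ((K.tensor W).obj b).obj c ⟶ a) :
    homEquiv ((re L f).obj b) ((re L f).obj c) ((re L f).obj a)
        ((K.comparison f b c).hom ≫ (re L f).map φ) =
      ⟨((H.elemRe T f).obj (H.elem T (homEquiv b c a φ).1)).hom,
        (re L f).map (homEquiv b c a φ).2 ≫
          (residRe f).inv.app (H.elem T (homEquiv b c a φ).1)⟩

end Cotractable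

section Formula

variable {C : Type u} [Category.{v} C] [CartesianMonoidalCategory C]
  {D : IndexedCat.{v, u, v₁, u₁} C} {T : IndexedTerminal D} {K : Comprehension T}
  (S : StrongSigma K) (P : PiTypes K) (Δ : Democracy K)
  {L : IndexedCat.{v, u, v₂, u₂} C} (R : ProjectionPi L) {O : FibreTensor L}
  (Q : Cotractable T O)

/-- The context `X`, in the form `1.X`. -/
abbrev ctx₁ (X : C) : C := K.ctx (𝟙_ C) (Δ.code X)

/-- The type `Y` over the context `X`. -/
abbrev wk (X Y : C) : fib D (ctx₁ Δ X) := (re D (toUnit (ctx₁ Δ X))).obj (Δ.code Y)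

/-- The context `X.Y`. -/
abbrev ctx₂ (X Y : C) : C := K.ctx (ctx₁ Δ X) (wk Δ X Y)

/-- The projection `X.Y ⟶ X`. -/
def pr₁ (X Y : C) : ctx₂ Δ X Y ⟶ X := K.p (ctx₁ Δ X) (wk Δ X Y) ≫ (Δ.iso X).hom

/-- The projection `X.Y ⟶ Y`. -/
def pr₂ (X Y : C) : ctx₂ Δ X Y ⟶ Y := K.q (toUnit (ctx₁ Δ X)) (Δ.code Y) ≫ (Δ.iso Y).hom

/-- The type `T x ⊸ y` over the context `X.Y`. -/
abbrev homType (A B : Total L) : fib D (ctx₂ Δ A.base B.base) :=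
  (Q.hom _).obj (op ((re L (pr₁ Δ A.base B.base)).obj A.fiber),
    (re L (pr₂ Δ A.base B.base)).obj B.fiber)

/-- The type `Σ_Y (T x ⊸ y)` over the context `X`. -/
abbrev sigmaType (A B : Total L) : fib D (ctx₁ Δ A.base) :=
  (S.sigma (wk Δ A.base B.base)).obj (homType Δ Q A B)

/-- The closed type `Π_X Σ_Y (T x ⊸ y)`. -/
abbrev piType (A B : Total L) : fib D (𝟙_ C) :=
  (P.pi (Δ.code A.base)).obj (sigmaType S Δ Q A B)

/-- The object `Π_X Σ_Y (T x ⊸ y)` of the base. -/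
abbrev expBase (A B : Total L) : C := K.ctx (𝟙_ C) (piType S P Δ Q A B)

/-- The context `X.Y.(T x ⊸ y)`. -/
abbrev ctx₃ (A B : Total L) : C := K.ctx (ctx₂ Δ A.base B.base) (homType Δ Q A B)

/-- The generic element `v : 1 ⟶ T x ⊸ y` over the context `X.Y.(T x ⊸ y)`. -/
def genericHom (A B : Total L) :
    T.one (ctx₃ Δ Q A B) ⟶ (Q.hom (ctx₃ Δ Q A B)).obj
      (op ((re L (K.p _ (homType Δ Q A B))).obj ((re L (pr₁ Δ A.base B.base)).obj A.fiber)),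
        (re L (K.p _ (homType Δ Q A B))).obj ((re L (pr₂ Δ A.base B.base)).obj B.fiber)) :=
  K.gen _ (homType Δ Q A B) ≫ (Q.homRe (K.p _ (homType Δ Q A B))).inv.app
    (op ((re L (pr₁ Δ A.base B.base)).obj A.fiber), (re L (pr₂ Δ A.base B.base)).obj B.fiber)

/-- The object `∂v` over the context `X.Y.(T x ⊸ y)`. -/
def residGeneric (A B : Total L) : fib L (ctx₃ Δ Q A B) :=
  (Q.resid _).obj (Q.elem T (genericHom Δ Q A B))

/-- The second projection from `(Π_X Σ_Y (T x ⊸ y)) × X`, into the context `1.X`. -/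
def arg (A B : Total L) : expBase S P Δ Q A B ⊗ A.base ⟶ ctx₁ Δ A.base :=
  snd _ _ ≫ (Δ.iso A.base).inv

/-- The evaluation of the generic element of `Π_X Σ_Y (T x ⊸ y)`, as an element of
`Σ_Y (T x ⊸ y)` over `(Π_X Σ_Y (T x ⊸ y)) × X`. -/
def evalElem (A B : Total L) :
    T.one (expBase S P Δ Q A B ⊗ A.base) ⟶
      (re D (arg S P Δ Q A B)).obj (sigmaType S Δ Q A B) :=
  (T.reIsTerminal (fst (expBase S P Δ Q A B) A.base)).from _ ≫
    (re D (fst (expBase S P Δ Q A B) A.base)).map (K.gen (𝟙_ C) (piType S P Δ Q A B)) ≫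
    (reSquare D (fst _ _) (arg S P Δ Q A B) (K.p (𝟙_ C) (piType S P Δ Q A B))
      (K.p (𝟙_ C) (Δ.code A.base)) (toUnit_unique _ _)).hom.app (piType S P Δ Q A B) ≫
    (re D (arg S P Δ Q A B)).map ((P.adj (Δ.code A.base)).counit.app (sigmaType S Δ Q A B))

/-- The evaluation map `(Π_X Σ_Y (T x ⊸ y)) × X ⟶ X.Σ_Y (T x ⊸ y)`. -/
def evalMap (A B : Total L) :
    expBase S P Δ Q A B ⊗ A.base ⟶ K.ctx (ctx₁ Δ A.base) (sigmaType S Δ Q A B) :=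
  K.adj.homEquiv (expBase S P Δ Q A B ⊗ A.base) ⟨ctx₁ Δ A.base, sigmaType S Δ Q A B⟩
    (tmk (x := ⟨_, T.one (expBase S P Δ Q A B ⊗ A.base)⟩)
      (y := ⟨ctx₁ Δ A.base, sigmaType S Δ Q A B⟩) (arg S P Δ Q A B) (evalElem S P Δ Q A B))

/-- The map `ζ : (Π_X Σ_Y (T x ⊸ y)) × X ⟶ X.Y.(T x ⊸ y)`. -/
noncomputable def zeta (A B : Total L) :
    expBase S P Δ Q A B ⊗ A.base ⟶ ctx₃ Δ Q A B :=
  evalMap S P Δ Q A B ≫ (S.pair (wk Δ A.base B.base) (homType Δ Q A B)).inv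

/-- The object `(X, x) ⊸ (Y, y) = (Π_X Σ_Y (T x ⊸ y), Π_X ζ^*(∂v))` of `Σ_C L`. -/
noncomputable def dialecticaHom (A B : Total L) : Total L :=
  ⟨expBase S P Δ Q A B,
    (R.pi (expBase S P Δ Q A B) A.base).obj ((re L (zeta S P Δ Q A B)).obj
      (residGeneric Δ Q A B))⟩

end Formula

end Dialectica

open Dialectica

/-! Write A = (X, x) and B = (Y, y), and let (Z, z) be a third object of `Total L`. The proof
characterizes morphisms (Z, z) ⟶ A ⊸ B by two successive universal properties. The intermediate
datum is a morphism of `Total L` into (X.Y.(Tx ⊸ y), ∂v) whose base lies over X.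

First property (`existsUnique_uncurryAt`). A base map m : Z ⟶ Π_X Σ_Y (Tx ⊸ y) is the same as a map
k = (m × X) ≫ ζ from Z × X to X.Y.(Tx ⊸ y) over X. This is the universal property of the Π-type
combined with the strong Σ isomorphism (`existsUnique_evalMap`, `existsUnique_zeta`). By
Beck–Chevalley for the Π_X of `L`, a fibre map z ⟶ m^* Π_X ζ^*(∂v) is the same as a map π₁^* z ⟶
k^*(∂v). Together these give a morphism (Z × X, π₁^* z) ⟶ (X.Y.(Tx ⊸ y), ∂v) over X.

Second property (`existsUnique_act_comp_residEval`). Fix a : V ⟶ X and c in `L` over V. A map k : V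
⟶ X.Y.(Tx ⊸ y) over a amounts to a map f : V ⟶ Y with an element g of T a^*x ⊸ f^*y, and k^*(∂v) is
then ∂(a^*x, f^*y, g). So a morphism (V, c) ⟶ (X.Y.(Tx ⊸ y), ∂v) over a is a triple of f, g and c ⟶
∂(a^*x, f^*y, g). Cotractability turns this into f with a^*x ⊗ c ⟶ f^*y, that is, a morphism (V,
a^*x ⊗ c) ⟶ B.

Taking V = X × Z or Z × X and c the reindexing of z gives the adjunction bijection. The tensor
enters only through an abstract `FibreTensor` with coherent comparisons, so the standard and the
reversed product are handled by the same argument. Naturality in (Z, z) is functoriality of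
reindexing and of the operation a^*x ⊗ (-). -/

namespace Dialectica

/-! ### Cartesian and vertical morphisms of the Grothendieck construction -/

section Total

variable {C : Type u} [Category.{v} C] {L : IndexedCat.{v, u, v', u'} C}

variable (L) in
/-- The iterated and the direct reindexing of `z`. -/
def reC₂ {X Y Z W : C} (f : X ⟶ Y) (g : Y ⟶ Z) (h : Z ⟶ W)
    (k : X ⟶ W) (w : f ≫ g ≫ h = k) (z : fib L W) :
    (re L f).obj ((re L g).obj ((re L h).obj z)) ≅ (re L k).obj z :=
  (re L f).mapIso (reC L g h (g ≫ h) rfl z) ≪≫ reC L f (g ≫ h) k w z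

-- The cocycle condition at the level of isomorphisms: a double reindexing through the middle object
-- can be replaced by a single one along the composite `l`.
variable (L) in
lemma reC_trans_reC {X Y Z W : C} (f : X ⟶ Y) (g : Y ⟶ Z) (h : Z ⟶ W)
    (k : X ⟶ W) (w : f ≫ g ≫ h = k) (z : fib L W) (l : X ⟶ Z) (w' : f ≫ g = l)
    (w'' : l ≫ h = k) :
    reC L f g l w' ((re L h).obj z) ≪≫ reC L l h k w'' z = reC₂ L f g h k w z :=
  Iso.ext (reC_assoc L f g h l (g ≫ h) k w' rfl w'' w z)

lemma tmk_injective {x y : Total L} (f : x.base ⟶ y.base) :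
    Function.Injective (fun φ : x.fiber ⟶ (re L f).obj y.fiber => tmk f φ) := by
  intro φ ψ h
  change Pseudofunctor.CoGrothendieck.Hom.mk f φ = Pseudofunctor.CoGrothendieck.Hom.mk f ψ at h
  injection h

lemma cpt_tmk_self {x y : Total L} (f : x.base ⟶ y.base)
    (φ : x.fiber ⟶ (re L f).obj y.fiber) :
    cpt (tmk f φ) (𝟙 _) f (Category.id_comp _) = (reI L _).hom ≫ φ :=
  cpt_self (tmk f φ)

lemma tmk_comp_tmk {x y z : Total L} (f : x.base ⟶ y.base) (φ : x.fiber ⟶ (re L f).obj y.fiber)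
    (g : y.base ⟶ z.base) (ψ : y.fiber ⟶ (re L g).obj z.fiber) :
    tmk f φ ≫ tmk g ψ =
      tmk (f ≫ g) (φ ≫ (re L f).map ψ ≫ (reC L f g (f ≫ g) rfl z.fiber).hom) := by
  change tmk (f ≫ g) (tfib (tmk f φ ≫ tmk g ψ)) = _
  rw [tfib_comp]
  rfl

/-- The cartesian morphism `(V, f^* w) ⟶ (W, w)`. -/
def cart {V : C} {y : Total L} (f : V ⟶ y.base) : (⟨V, (re L f).obj y.fiber⟩ : Total L) ⟶ y :=
  tmk f (𝟙 _)

/-- The factorization of a morphism through a cartesian morphism. -/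
def cartLift {x y : Total L} (Φ : x ⟶ y) {V : C} (f : V ⟶ y.base) (θ : x.base ⟶ V)
    (w : θ ≫ f = tbase Φ) : x ⟶ (⟨V, (re L f).obj y.fiber⟩ : Total L) :=
  tmk θ (tfib Φ ≫ (reC L θ f (tbase Φ) w y.fiber).inv)

lemma tmk_comp_cart {x y : Total L} {V : C} (f : V ⟶ y.base) (θ : x.base ⟶ V)
    (φ : x.fiber ⟶ (re L θ).obj ((re L f).obj y.fiber)) (h : x.base ⟶ y.base) (w : θ ≫ f = h) :
    tmk (x := x) (y := ⟨V, (re L f).obj y.fiber⟩) θ φ ≫ cart f =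
      tmk h (φ ≫ (reC L θ f h w y.fiber).hom) := by
  subst w
  refine (tmk_comp_tmk _ _ _ _).trans ?_
  rw [CategoryTheory.Functor.map_id, Category.id_comp]

lemma cartLift_comp_cart {x y : Total L} (Φ : x ⟶ y) {V : C} (f : V ⟶ y.base) (θ : x.base ⟶ V)
    (w : θ ≫ f = tbase Φ) : cartLift Φ f θ w ≫ cart f = Φ := by
  refine (tmk_comp_cart f θ _ _ w).trans ?_
  simp only [Category.assoc, Iso.inv_hom_id, Category.comp_id]
  rfl

lemma cart_hom_ext {x y : Total L} {V : C} {f : V ⟶ y.base}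
    {Φ Ψ : x ⟶ (⟨V, (re L f).obj y.fiber⟩ : Total L)} (h : tbase Φ = tbase Ψ)
    (h' : Φ ≫ cart f = Ψ ≫ cart f) : Φ = Ψ := by
  obtain ⟨θ, φ⟩ := Φ
  obtain ⟨θ', ψ⟩ := Ψ
  change θ = θ' at h
  subst h
  have h₁ := tmk_comp_cart f θ φ (θ ≫ f) rfl
  have h₂ := tmk_comp_cart f θ ψ (θ ≫ f) rfl
  have := tmk_injective _ (h₁.symm.trans (h'.trans h₂))
  exact congrArg (tmk (x := x) (y := ⟨V, (re L f).obj y.fiber⟩) θ)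
    ((Iso.cancel_iso_hom_right _ _ (reC L θ f (θ ≫ f) rfl y.fiber)).1 this)

/-- The universal property of cartesian morphisms. Working with it hides the compositors of the
pseudofunctor: equalities below are tested after composition with `cart`. -/
lemma existsUnique_comp_cart {x y : Total L} {V : C} (f : V ⟶ y.base) (θ : x.base ⟶ V)
    (Θ : x ⟶ y) (w : tbase Θ = θ ≫ f) :
    ∃! Φ : x ⟶ (⟨V, (re L f).obj y.fiber⟩ : Total L), tbase Φ = θ ∧ Φ ≫ cart f = Θ :=
  ⟨cartLift Θ f θ w.symm, ⟨rfl, cartLift_comp_cart _ _ _ _⟩,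
    fun _ h => cart_hom_ext h.1 (h.2.trans (cartLift_comp_cart _ _ _ _).symm)⟩

/-- The vertical morphism given by a morphism of a fibre. -/
def vert {W : C} {w w' : fib L W} (φ : w ⟶ w') : (⟨W, w⟩ : Total L) ⟶ ⟨W, w'⟩ :=
  tmk (x := ⟨W, w⟩) (y := ⟨W, w'⟩) (𝟙 W) (φ ≫ (reI L w').inv)

@[simp] lemma tbase_vert {W : C} {w w' : fib L W} (φ : w ⟶ w') : tbase (vert φ) = 𝟙 W := rfl

lemma tmk_comp_vert {x : Total L} {W : C} {w w' : fib L W} (f : x.base ⟶ W)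
    (ψ : x.fiber ⟶ (re L f).obj w) (φ : w ⟶ w') :
    tmk (y := ⟨W, w⟩) f ψ ≫ vert φ = tmk (y := ⟨W, w'⟩) f (ψ ≫ (re L f).map φ) := by
  refine total_hom_ext f (Category.comp_id f) rfl ?_
  rw [cpt_comp (tmk (y := ⟨W, w⟩) f ψ) (vert φ) (𝟙 _) f f (by simp) (by simp)]
  have h : cpt (vert φ) f f (by simp) = (re L f).map φ := by
    have hf : f ≫ 𝟙 W = f := Category.comp_id f
    change (re L f).map (φ ≫ (reI L w').inv) ≫ (reC L f (𝟙 W) f hf w').hom = _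
    rw [reC_id_right, ← Functor.map_comp, Category.assoc, Iso.inv_hom_id, Category.comp_id]
  rw [h]
  refine (congrArg (· ≫ _) (cpt_self (tmk (y := ⟨W, w⟩) f ψ))).trans ?_
  refine Eq.trans ?_ (cpt_self (tmk (y := ⟨W, w'⟩) f (ψ ≫ (re L f).map φ))).symm
  exact Category.assoc _ _ _

/-- The morphism between reindexed objects induced by a morphism of `Σ_C L` and a commutative
square of the base. -/
def cyl {x y : Total L} (Ψ : x ⟶ y) {V V' : C} (c : V ⟶ x.base) (c' : V' ⟶ y.base)
    (θ : V ⟶ V') (w : θ ≫ c' = c ≫ tbase Ψ) :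
    (⟨V, (re L c).obj x.fiber⟩ : Total L) ⟶ ⟨V', (re L c').obj y.fiber⟩ :=
  cartLift (cart c ≫ Ψ) c' θ w

lemma cyl_comp_cart {x y : Total L} (Ψ : x ⟶ y) {V V' : C} (c : V ⟶ x.base)
    (c' : V' ⟶ y.base) (θ : V ⟶ V') (w : θ ≫ c' = c ≫ tbase Ψ) :
    cyl Ψ c c' θ w ≫ cart c' = cart c ≫ Ψ :=
  cartLift_comp_cart _ _ _ _

/-- Both sides have the same base and the same composite with the cartesian morphism over `c''`, so
no coherence computation is needed. -/
lemma cyl_comp_cyl {x y z : Total L} (Ψ : x ⟶ y) (Ψ' : y ⟶ z) {V V' V'' : C} (c : V ⟶ x.base)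
    (c' : V' ⟶ y.base) (c'' : V'' ⟶ z.base) (θ : V ⟶ V') (θ' : V' ⟶ V'') (θ'' : V ⟶ V'')
    (w : θ ≫ c' = c ≫ tbase Ψ) (w' : θ' ≫ c'' = c' ≫ tbase Ψ') (h : θ ≫ θ' = θ'')
    (w'' : θ'' ≫ c'' = c ≫ tbase (Ψ ≫ Ψ')) :
    cyl Ψ c c' θ w ≫ cyl Ψ' c' c'' θ' w' = cyl (Ψ ≫ Ψ') c c'' θ'' w'' := by
  refine cart_hom_ext h ?_
  rw [Category.assoc, cyl_comp_cart, cyl_comp_cart, ← Category.assoc, cyl_comp_cart,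
    Category.assoc]

lemma cyl_id (x : Total L) {V : C} (c : V ⟶ x.base) (w : 𝟙 V ≫ c = c ≫ tbase (𝟙 x)) :
    cyl (𝟙 x) c c (𝟙 V) w = 𝟙 _ := by
  refine cart_hom_ext rfl ?_
  rw [cyl_comp_cart, Category.comp_id, Category.id_comp]

/-- The explicit fibre component, needed to compare `cyl` with mates and tensor products. The maps
`m` and `k` are free variables tied by equations, so that the lemma applies whatever form the base
maps happen to have. -/
lemma tfib_cyl {x y : Total L} (Ψ : x ⟶ y) {V V' : C} (c : V ⟶ x.base) (c' : V' ⟶ y.base)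
    (θ : V ⟶ V') (m : x.base ⟶ y.base) (hm : tbase Ψ = m) (k : V ⟶ y.base) (w : θ ≫ c' = k)
    (w' : c ≫ m = k) :
    tfib (cyl Ψ c c' θ (by rw [w, hm, w'])) =
      cpt Ψ c k (by rw [hm, w']) ≫ (reC L θ c' k w y.fiber).inv := by
  subst hm w'
  refine congrArg (· ≫ _) ?_
  change tfib (cart c ≫ Ψ) = _
  rw [tfib_comp]
  exact Category.id_comp _

lemma cyl_eq {x y : Total L} (Ψ : x ⟶ y) {V V' : C} (c : V ⟶ x.base) (c' : V' ⟶ y.base)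
    (θ : V ⟶ V') (m : x.base ⟶ y.base) (hm : tbase Ψ = m) (k : V ⟶ y.base) (w : θ ≫ c' = k)
    (w' : c ≫ m = k) :
    cyl Ψ c c' θ (by rw [w, hm, w']) = tmk (x := ⟨V, (re L c).obj x.fiber⟩)
      (y := ⟨V', (re L c').obj y.fiber⟩) θ
      (cpt Ψ c k (by rw [hm, w']) ≫ (reC L θ c' k w y.fiber).inv) :=
  congrArg (tmk (x := ⟨V, (re L c).obj x.fiber⟩) (y := ⟨V', (re L c').obj y.fiber⟩) θ)
    (tfib_cyl Ψ c c' θ m hm k w w')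

end Total

/-! ### Beck–Chevalley conditions as universal properties in the total category -/

section BeckChevalley

/-- Transposing the displayed composite along `adj₂` gives `h` followed by the mate. Postcomposition
with an invertible map is bijective, and so is transposition. -/
lemma bijective_of_isIso_mate {A : Type*} {A' : Type*} {B : Type*} {B' : Type*} [Category A]
    [Category A'] [Category B] [Category B'] {L₁ : A ⥤ B} {R₁ : B ⥤ A} {L₂ : A' ⥤ B'}
    {R₂ : B' ⥤ A'} (adj₁ : L₁ ⊣ R₁) (adj₂ : L₂ ⊣ R₂) {G : A ⥤ A'} {H : B ⥤ B'}
    (α : TwoSquare G L₁ L₂ H) [IsIso (mateEquiv adj₁ adj₂ α).natTrans] (a' : A') (b : B) :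
    Function.Bijective (fun h : a' ⟶ G.obj (R₁.obj b) =>
      L₂.map h ≫ α.natTrans.app (R₁.obj b) ≫ H.map (adj₁.counit.app b)) := by
  have key : ∀ h : a' ⟶ G.obj (R₁.obj b), adj₂.homEquiv a' (H.obj b)
      (L₂.map h ≫ α.natTrans.app (R₁.obj b) ≫ H.map (adj₁.counit.app b)) =
        h ≫ (mateEquiv adj₁ adj₂ α).natTrans.app b := by
    intro h
    simp [Adjunction.homEquiv_unit, mateEquiv]
  have hb : Function.Bijective (fun h : a' ⟶ G.obj (R₁.obj b) =>
      (h ≫ (mateEquiv adj₁ adj₂ α).natTrans.app b : a' ⟶ R₂.obj (H.obj b))) :=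
    ⟨fun _ _ h => (cancel_mono _).1 h,
      fun k => ⟨k ≫ inv ((mateEquiv adj₁ adj₂ α).natTrans.app b), by simp⟩⟩
  refine (Function.Bijective.of_comp_iff' (adj₂.homEquiv a' (H.obj b)).bijective _).1 ?_
  rwa [show (adj₂.homEquiv a' (H.obj b) ∘ _) = _ from funext key]

variable {C : Type u} [Category.{v} C] {L : IndexedCat.{v, u, v', u'} C}

lemma reSquare_hom_app {A B E F : C} (t : A ⟶ B) (l : A ⟶ E) (r : B ⟶ F) (b : E ⟶ F)
    (w : t ≫ r = l ≫ b) (z : fib L F) : (reSquare L t l r b w).hom.app z =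
      (reC L t r (t ≫ r) rfl z).hom ≫ (reC L l b (t ≫ r) w.symm z).inv := rfl

/-- For a commutative square `c ≫ m = d ≫ r` of the base and a right adjoint `Pi` of `r^*`:
morphisms `(Z, z) ⟶ (W, Pi s)` over `m` correspond to morphisms `(V, c^* z) ⟶ (E, s)` over `d`. -/
def HasTransposes {V Z W E : C} {r : E ⟶ W} {Pi : fib L E ⥤ fib L W} (adj : re L r ⊣ Pi)
    (c : V ⟶ Z) (d : V ⟶ E) (m : Z ⟶ W) (w : d ≫ r = c ≫ m) : Prop :=
  ∀ (z : fib L Z) (s : fib L E) (Φ : (⟨V, (re L c).obj z⟩ : Total L) ⟶ ⟨E, s⟩), tbase Φ = d →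
    ∃! Ψ : (⟨Z, z⟩ : Total L) ⟶ ⟨W, Pi.obj s⟩, ∃ h : tbase Ψ = m,
      cyl Ψ c r d (by rw [w, h]) ≫ vert (adj.counit.app s) = Φ

/-- The fibre component of `cyl` followed by the counit is exactly the composite of
`bijective_of_isIso_mate`, so invertibility of the mate yields existence and uniqueness of
transposes. -/
lemma hasTransposes_of_isIso_mate {V Z W E : C} {r : E ⟶ W} {Pi : fib L E ⥤ fib L W}
    (adj : re L r ⊣ Pi) {c : V ⟶ Z} {Pi' : fib L V ⥤ fib L Z} (adj' : re L c ⊣ Pi')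
    (d : V ⟶ E) (m : Z ⟶ W) (w : c ≫ m = d ≫ r)
    (h : IsIso (mateEquiv (G := re L m) (H := re L d) adj adj'
        (TwoSquare.mk _ _ _ _ (reSquare L c d m r w).hom)).natTrans) :
    HasTransposes adj c d m w.symm := by
  intro z s Φ hΦ
  obtain ⟨d', φ⟩ := Φ
  change d' = d at hΦ
  subst hΦ
  have key : ∀ n : z ⟶ (re L m).obj (Pi.obj s),
      cyl (tmk (x := ⟨Z, z⟩) (y := ⟨W, Pi.obj s⟩) m n) c r d' w.symm ≫ vert (adj.counit.app s) =
        tmk (x := ⟨V, (re L c).obj z⟩) (y := ⟨E, s⟩) d'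
          ((re L c).map n ≫ (reSquare L c d' m r w).hom.app (Pi.obj s) ≫
            (re L d').map (adj.counit.app s)) := by
    intro n
    rw [cyl_eq (tmk (x := ⟨Z, z⟩) (y := ⟨W, Pi.obj s⟩) m n) c r d' m rfl (c ≫ m) w.symm rfl]
    refine (tmk_comp_vert _ _ _).trans ?_
    refine congrArg (tmk (x := ⟨V, (re L c).obj z⟩) (y := ⟨E, s⟩) d') ?_
    simp only [reSquare_hom_app, cpt, Category.assoc]
    rfl
  have hb := bijective_of_isIso_mate adj adj'
    (TwoSquare.mk _ _ _ _ (reSquare L c d' m r w).hom) z s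
  obtain ⟨n, hn⟩ := hb.2 φ
  refine ⟨tmk (x := ⟨Z, z⟩) (y := ⟨W, Pi.obj s⟩) m n, ⟨rfl, (key n).trans ?_⟩, ?_⟩
  · exact congrArg (tmk (x := ⟨V, (re L c).obj z⟩) (y := ⟨E, s⟩) d') hn
  · rintro ⟨m', n'⟩ ⟨h₁, h₂⟩
    change m' = m at h₁
    subst h₁
    refine congrArg (tmk (x := ⟨Z, z⟩) (y := ⟨W, Pi.obj s⟩) m') (hb.1 ?_)
    refine Eq.trans ?_ hn.symm
    exact tmk_injective (x := ⟨V, (re L c).obj z⟩) (y := ⟨E, s⟩) d' ((key n').symm.trans h₂)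

/-- Beck–Chevalley for dependent Π-types speaks of the context extension `Z.X`, whereas the formula
uses the product `Z × X`. This allows one to be replaced by the other, and also the factors of a
product to be swapped. -/
lemma HasTransposes.of_iso {V Z W E : C} {r : E ⟶ W} {Pi : fib L E ⥤ fib L W}
    {adj : re L r ⊣ Pi} {c : V ⟶ Z} {d : V ⟶ E} {m : Z ⟶ W} {w : d ≫ r = c ≫ m}
    (H : HasTransposes adj c d m w) {V' : C} (j : V' ≅ V) (c' : V' ⟶ Z) (d' : V' ⟶ E)
    (hc : j.hom ≫ c = c') (hd : j.hom ≫ d = d') :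
    HasTransposes adj c' d' m (by rw [← hc, ← hd, Category.assoc, Category.assoc, w]) := by
  intro z s Φ hΦ
  have hc' : j.inv ≫ c' = c ≫ tbase (𝟙 (⟨Z, z⟩ : Total L)) := by
    rw [← hc]; simp
  have hc'' : j.hom ≫ c = c' ≫ tbase (𝟙 (⟨Z, z⟩ : Total L)) := by
    rw [← hc]; simp
  -- The isomorphism `j` of bases lifts to mutually inverse morphisms between (V, c^* z) and (V',
  -- c'^* z); transposes for `c'` are those for `c` precomposed with one of them.
  let e := cyl (𝟙 (⟨Z, z⟩ : Total L)) c c' j.inv hc'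
  let e' := cyl (𝟙 (⟨Z, z⟩ : Total L)) c' c j.hom hc''
  have he : e ≫ e' = 𝟙 _ := by
    refine (cyl_comp_cyl _ _ _ _ _ _ _ (𝟙 _) _ _ (by simp) (by simp)).trans ?_
    simp only [Category.comp_id]
    exact cyl_id (⟨Z, z⟩ : Total L) c _
  have he' : e' ≫ e = 𝟙 _ := by
    refine (cyl_comp_cyl _ _ _ _ _ _ _ (𝟙 _) _ _ (by simp) (by simp)).trans ?_
    simp only [Category.comp_id]
    exact cyl_id (⟨Z, z⟩ : Total L) c' _
  have key : ∀ Ψ : (⟨Z, z⟩ : Total L) ⟶ ⟨W, Pi.obj s⟩, ∀ w₁ w₂,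
      cyl Ψ c' r d' w₁ ≫ vert (adj.counit.app s) =
        e' ≫ cyl Ψ c r d w₂ ≫ vert (adj.counit.app s) := by
    intro Ψ w₁ w₂
    rw [← Category.assoc]
    congr 1
    refine Eq.symm ((cyl_comp_cyl _ _ _ _ _ _ _ d' _ _ hd (by simp; exact w₁)).trans ?_)
    simp only [Category.id_comp]
  obtain ⟨Ψ, ⟨h₁, h₂⟩, h₃⟩ := H z s (e ≫ Φ) (by
    rw [tbase_comp, hΦ, ← hd]; exact j.inv_hom_id_assoc d)
  refine ⟨Ψ, ⟨h₁, ?_⟩, ?_⟩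
  · rw [key Ψ _ (by rw [w, h₁]), h₂, reassoc_of% he']
  · rintro Ψ' ⟨h₁', h₂'⟩
    refine h₃ Ψ' ⟨h₁', ?_⟩
    rw [← h₂', key Ψ' _ (by rw [w, h₁']), reassoc_of% he]

end BeckChevalley

/-! ### Tensoring with reindexings of a fixed object -/

section Act

variable {C : Type u} [Category.{v} C] {L : IndexedCat.{v, u, v', u'} C} (O : FibreTensor L)

/-- The action of a binary operation on a pair of morphisms. -/
def FibreTensor.map₂ {W : C} {b b' c c' : fib L W} (β : b ⟶ b') (γ : c ⟶ c') :
    ((O.tensor W).obj b).obj c ⟶ ((O.tensor W).obj b').obj c' :=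
  ((O.tensor W).map β).app c ≫ ((O.tensor W).obj b').map γ

lemma FibreTensor.map₂_comp {W : C} {b b' b'' c c' c'' : fib L W} (β : b ⟶ b') (γ : c ⟶ c')
    (β' : b' ⟶ b'') (γ' : c' ⟶ c'') :
    O.map₂ β γ ≫ O.map₂ β' γ' = O.map₂ (β ≫ β') (γ ≫ γ') := by
  simp [FibreTensor.map₂]

/-- Naturality of the comparison isomorphisms of a binary operation on the fibres, and their
compatibility with the compositors. -/
structure FibreTensor.IsCoherent : Prop where
  natural {W' W : C} (f : W' ⟶ W) {b b' c c' : fib L W} (β : b ⟶ b') (γ : c ⟶ c') :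
    (O.comparison f b c).hom ≫ (re L f).map (O.map₂ β γ) =
      O.map₂ ((re L f).map β) ((re L f).map γ) ≫ (O.comparison f b' c').hom
  comp {X Y Z : C} (f : X ⟶ Y) (g : Y ⟶ Z) (h : X ⟶ Z) (w : f ≫ g = h) (b c : fib L Z) :
    (O.comparison f _ _).hom ≫ (re L f).map (O.comparison g b c).hom ≫
        (reC L f g h w _).hom =
      O.map₂ (reC L f g h w b).hom (reC L f g h w c).hom ≫ (O.comparison h b c).hom

variable {O}

/-- The operation with a reindexing of `x`, as a functor on the objects of `Σ_C L` over `X`. -/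
def act (O : FibreTensor L) {X : C} (x : fib L X) {s t : Total L} (Θ : s ⟶ t) (a : s.base ⟶ X)
    (b : t.base ⟶ X) (w : tbase Θ ≫ b = a) :
    (⟨s.base, ((O.tensor _).obj ((re L a).obj x)).obj s.fiber⟩ : Total L) ⟶
      ⟨t.base, ((O.tensor _).obj ((re L b).obj x)).obj t.fiber⟩ :=
  tmk (x := ⟨s.base, ((O.tensor _).obj ((re L a).obj x)).obj s.fiber⟩)
    (y := ⟨t.base, ((O.tensor _).obj ((re L b).obj x)).obj t.fiber⟩) (tbase (x := s) (y := t) Θ)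
    (O.map₂ (reC L (tbase Θ) b a w x).inv (tfib Θ) ≫ (O.comparison (tbase Θ) _ _).hom)

/-- Naturality slides the first comparison past the second morphism, and coherence with the
compositors merges the two comparisons. What remains is the cocycle condition for the reindexings of
`x`, isolated as `e`. -/
lemma act_comp (hO : O.IsCoherent) {X : C} (x : fib L X) {s t r : Total L} (Θ : s ⟶ t)
    (Θ' : t ⟶ r) (a : s.base ⟶ X) (b : t.base ⟶ X) (c : r.base ⟶ X) (w : tbase Θ ≫ b = a)
    (w' : tbase Θ' ≫ c = b) (w'' : tbase (Θ ≫ Θ') ≫ c = a) :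
    act O x Θ a b w ≫ act O x Θ' b c w' = act O x (Θ ≫ Θ') a c w'' := by
  refine (tmk_comp_tmk _ _ _ _).trans ?_
  refine congrArg (tmk (x := ⟨s.base, ((O.tensor _).obj ((re L a).obj x)).obj s.fiber⟩)
    (y := ⟨r.base, ((O.tensor _).obj ((re L c).obj x)).obj r.fiber⟩)
    (tbase (x := s) (y := t) Θ ≫ tbase (x := t) (y := r) Θ')) ?_
  have e : (reC L (tbase Θ) b a w x).inv ≫ (re L (tbase Θ)).map (reC L (tbase Θ') c b w' x).inv ≫
      (reC L (tbase Θ) (tbase Θ') (tbase Θ ≫ tbase Θ') rfl _).hom =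
        (reC L (tbase Θ ≫ tbase Θ') c a w'' x).inv := by
    rw [Iso.inv_comp_eq, Iso.eq_comp_inv, Category.assoc,
      reC_assoc L (tbase Θ) (tbase Θ') c (tbase Θ ≫ tbase Θ') b a rfl w' w'' w x,
      ← Functor.map_comp_assoc, Iso.inv_hom_id, CategoryTheory.Functor.map_id, Category.id_comp]
  rw [Functor.map_comp, Category.assoc, Category.assoc, reassoc_of% hO.natural,
    hO.comp (tbase Θ) (tbase Θ') (tbase Θ ≫ tbase Θ') rfl, ← Category.assoc, ← Category.assoc,
    O.map₂_comp, O.map₂_comp, Category.assoc, Category.assoc, e, tfib_comp]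
  rfl

end Act

/-! ### The tensor product of the total category expressed through the fibrewise action -/

section Tensor

open CartesianMonoidalCategory Functor.LaxMonoidal Functor.OplaxMonoidal Functor.Monoidal

variable {C : Type u} [Category.{v} C] {L : IndexedCat.{v, u, v', u'} C} [IndexedMonoidal L]

lemma standard_map₂ {W : C} {b b' c c' : fib L W} (β : b ⟶ b') (γ : c ⟶ c') :
    (FibreTensor.standard L).map₂ β γ = (β ⊗ₘ γ) :=
  (MonoidalCategory.tensorHom_def β γ).symm

lemma reversed_map₂ {W : C} {b b' c c' : fib L W} (β : b ⟶ b') (γ : c ⟶ c') :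
    (FibreTensor.reversed L).map₂ β γ = (γ ⊗ₘ β) :=
  (MonoidalCategory.tensorHom_def' γ β).symm

lemma μ_comp_reC {X Y Z : C} (f : X ⟶ Y) (g : Y ⟶ Z) (h : X ⟶ Z) (w : f ≫ g = h)
    (P Q : fib L Z) :
    μ (re L f) ((re L g).obj P) ((re L g).obj Q) ≫ (re L f).map (μ (re L g) P Q) ≫
        (reC L f g h w (P ⊗ Q)).hom =
      ((reC L f g h w P).hom ⊗ₘ (reC L f g h w Q).hom) ≫ μ (re L h) P Q := by
  have h1 := NatTrans.IsMonoidal.tensor (τ := (reComp L f g h w).hom) P Q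
  rw [Functor.LaxMonoidal.comp_μ, Category.assoc] at h1
  exact h1

lemma μ_comp_reI {X : C} (P Q : fib L X) :
    μ (re L (𝟙 X)) P Q ≫ (reI L (P ⊗ Q)).hom = ((reI L P).hom ⊗ₘ (reI L Q).hom) := by
  have h1 := NatTrans.IsMonoidal.tensor (τ := (reId L X).hom) P Q
  rw [Functor.LaxMonoidal.id_μ, Category.comp_id] at h1
  exact h1

variable (L) in
lemma standard_isCoherent : (FibreTensor.standard L).IsCoherent where
  natural f _ _ _ _ β γ := by
    rw [standard_map₂, standard_map₂]
    exact (μ_natural (re L f) β γ).symm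
  comp f g h w b c := by
    rw [standard_map₂]
    exact μ_comp_reC f g h w b c

variable (L) in
lemma reversed_isCoherent : (FibreTensor.reversed L).IsCoherent where
  natural f _ _ _ _ β γ := by
    rw [reversed_map₂, reversed_map₂]
    exact (μ_natural (re L f) γ β).symm
  comp f g h w b c := by
    rw [reversed_map₂]
    exact μ_comp_reC f g h w c b

variable [CartesianMonoidalCategory C]

/-- The product was defined through components at the identity stage; here it is brought into closed
form, with the target's tensor comparison `μ` at the end, as in the definition of `act`. -/
lemma tHom_eq {A A' Z Z' : Total L} (Φ : A ⟶ A') (Ψ : Z ⟶ Z')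
    (θ : A.base ⊗ Z.base ⟶ A'.base ⊗ Z'.base) (hθ : (tbase Φ ⊗ₘ tbase Ψ) = θ)
    (a₁ : A.base ⊗ Z.base ⟶ A'.base) (a₂ : A.base ⊗ Z.base ⟶ Z'.base)
    (h₁ : fst _ _ ≫ tbase Φ = a₁) (h₂ : snd _ _ ≫ tbase Ψ = a₂) (k₁ : θ ≫ fst _ _ = a₁)
    (k₂ : θ ≫ snd _ _ = a₂) :
    tHom Φ Ψ = tmk (x := tobj A Z) (y := tobj A' Z') θ
      (((cpt Φ (fst _ _) a₁ h₁ ≫ (reC L θ (fst _ _) a₁ k₁ A'.fiber).inv) ⊗ₘ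
        (cpt Ψ (snd _ _) a₂ h₂ ≫ (reC L θ (snd _ _) a₂ k₂ Z'.fiber).inv)) ≫
          μ (re L θ) _ _) := by
  subst hθ
  refine total_hom_ext (tbase Φ ⊗ₘ tbase Ψ) rfl rfl ?_
  have h := cpt_tHom Φ Ψ (𝟙 _) (tbase Φ ⊗ₘ tbase Ψ) (by simp) (fst _ _) (snd _ _)
    a₁ a₂ (by simp) (by simp) k₁ k₂ h₁ h₂
  refine h.trans (Eq.trans ?_ (cpt_tmk_self (x := tobj A Z) (y := tobj A' Z') _ _).symm)
  change _ = (reI L (_ ⊗ _)).hom ≫ _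
  -- Precomposing with the invertible `μ` at the identity turns the unitor of a tensor product into
  -- a tensor product of unitors.
  rw [← cancel_epi (μ (re L (𝟙 _)) _ _), reassoc_of% μ_comp_reI]
  simp [tens, reC_id_left]

/-- The bridge between the monoidal structure and the abstract action: the functor A ⊗ (-) reindexes
along the second projection and then acts by the fibre of `A`. The free map `θ` avoids committing to
a form of the base map. -/
lemma tensorHom_id_eq_act (A : Total L) {Z Z' : Total L} (Ψ : Z ⟶ Z')
    (θ : A.base ⊗ Z.base ⟶ A.base ⊗ Z'.base) (k₁ : θ ≫ fst _ _ = fst _ _)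
    (k₂ : θ ≫ snd _ _ = snd _ _ ≫ tbase Ψ) :
    tHom (𝟙 A) Ψ = act (FibreTensor.standard L) A.fiber
      (cyl Ψ (snd A.base Z.base) (snd A.base Z'.base) θ k₂) (fst _ _) (fst _ _) k₁ := by
  rw [tHom_eq (𝟙 A) Ψ θ (by ext <;> simp [k₁, k₂]) (fst _ _) _ (by simp) rfl k₁ k₂]
  refine congrArg (tmk (x := tobj A Z) (y := tobj A Z') θ) ?_
  refine Eq.trans ?_ (congrArg (fun t => (FibreTensor.standard L).map₂
    (reC L θ (fst _ _) (fst _ _) k₁ A.fiber).inv t ≫ μ (re L θ) _ _)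
      (tfib_cyl Ψ (snd A.base Z.base) (snd A.base Z'.base) θ _ rfl _ k₂ rfl)).symm
  rw [standard_map₂, cpt_id, Category.id_comp]
  rfl

lemma tensorHom_eq_act (A : Total L) {Z Z' : Total L} (Ψ : Z ⟶ Z')
    (θ : Z.base ⊗ A.base ⟶ Z'.base ⊗ A.base) (k₁ : θ ≫ fst _ _ = fst _ _ ≫ tbase Ψ)
    (k₂ : θ ≫ snd _ _ = snd _ _) :
    tHom Ψ (𝟙 A) = act (FibreTensor.reversed L) A.fiber
      (cyl Ψ (fst Z.base A.base) (fst Z'.base A.base) θ k₁) (snd _ _) (snd _ _) k₂ := by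
  rw [tHom_eq Ψ (𝟙 A) θ (by ext <;> simp [k₁, k₂]) _ (snd _ _) rfl (by simp) k₁ k₂]
  refine congrArg (tmk (x := tobj Z A) (y := tobj Z' A) θ) ?_
  refine Eq.trans ?_ (congrArg (fun t => (FibreTensor.reversed L).map₂
    (reC L θ (snd _ _) (snd _ _) k₂ A.fiber).inv t ≫ μ (re L θ) _ _)
      (tfib_cyl Ψ (fst Z.base A.base) (fst Z'.base A.base) θ _ rfl _ k₁ rfl)).symm
  rw [reversed_map₂, cpt_id, Category.id_comp]
  rfl

end Tensor

/-! ### Contexts as pullbacks and products, and transposes for Π-types -/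

section Comprehension

open CartesianMonoidalCategory

variable {C : Type u} [Category.{v} C] {D : IndexedCat.{v, u, v₁, u₁} C} {T : IndexedTerminal D}
  (K : Comprehension T)

variable (T) in
/-- The morphism `(V, 1) ⟶ (Z, 1)` over a morphism of the base. -/
def oneMap {V Z : C} (k : V ⟶ Z) : (⟨V, T.one V⟩ : Total D) ⟶ ⟨Z, T.one Z⟩ := T.unitSection.map k

/-- Maps into `W.w` correspond to morphisms `(V, 1) ⟶ (W, w)`. -/
def Comprehension.classify {V W : C} {w : fib D W} :
    ((⟨V, T.one V⟩ : Total D) ⟶ ⟨W, w⟩) ≃ (V ⟶ K.ctx W w) := K.adj.homEquiv V ⟨W, w⟩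

lemma Comprehension.classify_symm {V W : C} {w : fib D W} (k : V ⟶ K.ctx W w) :
    K.classify.symm k = oneMap T k ≫ K.counit W w :=
  K.adj.homEquiv_counit V ⟨W, w⟩ k

lemma Comprehension.classify_symm_comp {V' V W : C} {w : fib D W} (θ : V' ⟶ V)
    (k : V ⟶ K.ctx W w) : K.classify.symm (θ ≫ k) = oneMap T θ ≫ K.classify.symm k :=
  K.adj.homEquiv_naturality_left_symm θ k

lemma Comprehension.tbase_classify_symm {V W : C} {w : fib D W} (k : V ⟶ K.ctx W w) :
    tbase (K.classify.symm k) = k ≫ K.p W w := by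
  rw [K.classify_symm]
  rfl

lemma Comprehension.tfib_oneMap_comp_counit {V W : C} {w : fib D W}
    (k : V ⟶ K.ctx W w) :
    tfib (oneMap T k ≫ K.counit W w) = (T.reIsTerminal k).from (T.one V) ≫
      (re D k).map (K.gen W w) ≫ (reC D k (K.p W w) (k ≫ K.p W w) rfl w).hom :=
  tfib_comp _ _

/-- The element of `g^* w` given by a map into `W.w` over `g`. -/
def Comprehension.element {V W : C} {w : fib D W} (k : V ⟶ K.ctx W w) (g : V ⟶ W)
    (h : k ≫ K.p W w = g) : T.one V ⟶ (re D g).obj w :=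
  (T.reIsTerminal k).from (T.one V) ≫ (re D k).map (K.gen W w) ≫ (reC D k (K.p W w) g h w).hom

lemma Comprehension.classify_symm_eq {V W : C} {w : fib D W} (k : V ⟶ K.ctx W w) (g : V ⟶ W)
    (h : k ≫ K.p W w = g) :
    K.classify.symm k = tmk (x := ⟨V, T.one V⟩) (y := ⟨W, w⟩) g (K.element k g h) := by
  subst h
  rw [K.classify_symm]
  exact congrArg (tmk (x := ⟨V, T.one V⟩) (y := ⟨W, w⟩) (k ≫ K.p W w))
    (K.tfib_oneMap_comp_counit k)

/-- With `exists_element_eq`, this says that maps into `W.w` over `g` are the elements of `g^* w`: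
the comprehension adjunction restricted to a fixed base map. -/
lemma Comprehension.element_injective {V W : C} {w : fib D W} {k k' : V ⟶ K.ctx W w} {g : V ⟶ W}
    (h : k ≫ K.p W w = g) (h' : k' ≫ K.p W w = g) (e : K.element k g h = K.element k' g h') :
    k = k' := by
  refine K.classify.symm.injective ?_
  rw [K.classify_symm_eq k g h, K.classify_symm_eq k' g h', e]

lemma Comprehension.exists_element_eq {V W : C} {w : fib D W} (g : V ⟶ W)
    (s : T.one V ⟶ (re D g).obj w) :
    ∃ (k : V ⟶ K.ctx W w) (h : k ≫ K.p W w = g), K.element k g h = s := by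
  let Φ : (⟨V, T.one V⟩ : Total D) ⟶ ⟨W, w⟩ := tmk g s
  have hk : K.classify.symm (K.classify Φ) = Φ := Equiv.symm_apply_apply _ _
  have h : K.classify Φ ≫ K.p W w = g := by
    rw [← K.tbase_classify_symm, hk]
    rfl
  refine ⟨K.classify Φ, h, tmk_injective (x := ⟨V, T.one V⟩) (y := ⟨W, w⟩) g ?_⟩
  exact (K.classify_symm_eq _ g h).symm.trans hk

lemma Comprehension.classify_comp_p {V W : C} {w : fib D W}
    (Φ : (⟨V, T.one V⟩ : Total D) ⟶ ⟨W, w⟩) : K.classify Φ ≫ K.p W w = tbase Φ := by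
  rw [← K.tbase_classify_symm, Equiv.symm_apply_apply]

lemma Comprehension.classify_comp_q {V W' W : C} (f : W' ⟶ W) {w : fib D W}
    (Φ : (⟨V, T.one V⟩ : Total D) ⟶ ⟨W', (re D f).obj w⟩) :
    K.classify Φ ≫ K.q f w = K.classify (Φ ≫ cart (y := (⟨W, w⟩ : Total D)) f) :=
  (K.adj.homEquiv_naturality_right Φ (cart (y := (⟨W, w⟩ : Total D)) f)).symm

/-- The square formed by the projections and `q` is a pullback. -/
lemma Comprehension.existsUnique_lift {V W' W : C} (f : W' ⟶ W) (w : fib D W) (a : V ⟶ W')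
    (b : V ⟶ K.ctx W w) (h : b ≫ K.p W w = a ≫ f) :
    ∃! k : V ⟶ K.ctx W' ((re D f).obj w), k ≫ K.p W' _ = a ∧ k ≫ K.q f w = b := by
  -- Under `classify`, composition with `q` becomes composition with a cartesian morphism, so the
  -- pullback property is the cartesian property.
  obtain ⟨Φ, ⟨h₁, h₂⟩, h₃⟩ := existsUnique_comp_cart (x := ⟨V, T.one V⟩) (y := ⟨W, w⟩) f a
    (K.classify.symm b) ((K.tbase_classify_symm b).trans h)
  refine ⟨K.classify Φ, ⟨(K.classify_comp_p _).trans h₁, (K.classify_comp_q f _).trans ?_⟩, ?_⟩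
  · exact (K.classify.symm_apply_eq.1 h₂.symm).symm
  · rintro k ⟨rfl, rfl⟩
    rw [← K.classify.symm_apply_eq]
    refine h₃ _ ⟨K.tbase_classify_symm k, K.classify.injective ?_⟩
    rw [← K.classify_comp_q, Equiv.apply_symm_apply, Equiv.apply_symm_apply]

variable (T) in
/-- The comparison `(V, 1) ⟶ (V, c^* 1)`. -/
def oneRe {V Z : C} (c : V ⟶ Z) :
    (⟨V, T.one V⟩ : Total D) ≅ ⟨V, (re D c).obj (T.one Z)⟩ where
  hom := cartLift (y := ⟨Z, T.one Z⟩) (oneMap T c) c (𝟙 V) (Category.id_comp c)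
  inv := tmk (x := ⟨V, (re D c).obj (T.one Z)⟩) (y := ⟨V, T.one V⟩) (𝟙 V)
    ((T.reIsTerminal (𝟙 V)).from _)
  hom_inv_id := T.hom_ext (Category.id_comp (𝟙 V))
  inv_hom_id := cart_hom_ext (y := ⟨Z, T.one Z⟩) (Category.id_comp (𝟙 V))
    (T.hom_ext (congrArg (· ≫ c) (Category.id_comp (𝟙 V))))

lemma oneRe_hom_comp_cart {V Z : C} (c : V ⟶ Z) :
    (oneRe T c).hom ≫ cart (y := (⟨Z, T.one Z⟩ : Total D)) c = oneMap T c :=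
  cartLift_comp_cart (y := (⟨Z, T.one Z⟩ : Total D)) _ _ _ _

/-- After composition with the cartesian morphism both sides land in a fibrewise terminal object,
where a morphism is determined by its base. -/
lemma oneMap_comp_oneRe_hom {V V' Z Z' : C} (c : V ⟶ Z) (c' : V' ⟶ Z') (θ : V ⟶ V')
    (m : Z ⟶ Z') (w : θ ≫ c' = c ≫ m) :
    oneMap T θ ≫ (oneRe T c').hom = (oneRe T c).hom ≫
      cyl (x := ⟨Z, T.one Z⟩) (y := ⟨Z', T.one Z'⟩) (oneMap T m) c c' θ w := by
  refine cart_hom_ext (y := ⟨Z', T.one Z'⟩) ((Category.comp_id θ).trans (Category.id_comp θ).symm)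
    (T.hom_ext ?_)
  change (θ ≫ 𝟙 V') ≫ c' = (𝟙 V ≫ θ) ≫ c'
  simp

variable {K} in
lemma StrongSigma.pair_hom_comp_p (S : StrongSigma K) {W : C} (w : fib D W) (w' : fib D (K.ctx W w)) :
    (S.pair w w').hom ≫ K.p W ((S.sigma w).obj w') = K.p _ w' ≫ K.p W w :=
  K.ext_map_p (tmk (x := ⟨K.ctx W w, w'⟩) (y := ⟨W, (S.sigma w).obj w'⟩) (K.p W w)
      ((S.adj w).unit.app w'))

variable [CartesianMonoidalCategory C] {K} (Δ : Democracy K)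

/-- The context `X.Y` is the pullback of `1.X` and `1.Y` over the terminal object, hence a product
of `X` and `Y`. -/
lemma existsUnique_ctx₂_lift {V X Y : C} (a : V ⟶ X) (b : V ⟶ Y) :
    ∃! k : V ⟶ ctx₂ Δ X Y, k ≫ pr₁ Δ X Y = a ∧ k ≫ pr₂ Δ X Y = b := by
  obtain ⟨k, ⟨h₁, h₂⟩, h₃⟩ := K.existsUnique_lift (toUnit (ctx₁ Δ X)) (Δ.code Y)
    (a ≫ (Δ.iso X).inv) (b ≫ (Δ.iso Y).inv) (toUnit_unique _ _)
  refine ⟨k, ⟨?_, ?_⟩, ?_⟩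
  · rw [pr₁, reassoc_of% h₁, Iso.inv_hom_id, Category.comp_id]
  · rw [pr₂, reassoc_of% h₂, Iso.inv_hom_id, Category.comp_id]
  · rintro k' ⟨rfl, rfl⟩
    exact h₃ k' ⟨by simp [pr₁], by simp [pr₂]⟩

lemma exists_iso_ctx (Z X : C) :
    ∃ j : Z ⊗ X ≅ K.ctx Z ((re D (toUnit Z)).obj (Δ.code X)),
      j.hom ≫ K.p _ _ = fst Z X ∧ j.hom ≫ K.q _ _ = snd Z X ≫ (Δ.iso X).inv := by
  obtain ⟨k, ⟨h₁, h₂⟩, -⟩ := K.existsUnique_lift (toUnit Z) (Δ.code X)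
    (fst Z X) (snd Z X ≫ (Δ.iso X).inv) (toUnit_unique _ _)
  refine ⟨⟨k, lift (K.p _ _) (K.q _ _ ≫ (Δ.iso X).hom), ?_, ?_⟩, h₁, h₂⟩
  · ext
    · simp [h₁]
    · simp [reassoc_of% h₂]
  · refine (K.existsUnique_lift (toUnit Z) (Δ.code X) (K.p _ _) (K.q _ _)
      (toUnit_unique _ _)).unique ⟨?_, ?_⟩ ⟨?_, ?_⟩
    · simp [h₁]
    · simp [h₂]
    · simp
    · simp

/-- Beck–Chevalley along Z ⟶ 1 for the closed type `X`, carried from the context extension `Z.X` to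
the product. -/
lemma PiTypes.hasTransposes (P : PiTypes K) (Z X : C) :
    HasTransposes (P.adj (Δ.code X)) (fst Z X) (snd Z X ≫ (Δ.iso X).inv) (toUnit Z)
      (toUnit_unique _ _) := by
  obtain ⟨j, h₁, h₂⟩ := exists_iso_ctx Δ Z X
  exact (hasTransposes_of_isIso_mate (P.adj (Δ.code X))
    (P.adj ((re D (toUnit Z)).obj (Δ.code X))) (K.q _ _) (toUnit Z) (K.q_p _ _).symm
      (P.beckChevalley (toUnit Z) (Δ.code X))).of_iso j _ _ h₁ h₂

lemma ProjectionPi.hasTransposes {L : IndexedCat.{v, u, v₂, u₂} C} (R : ProjectionPi L)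
    {Z W : C} (m : Z ⟶ W) (X : C) :
    HasTransposes (R.adj W X) (fst Z X) (m ▷ X) m (whiskerRight_fst m X) :=
  hasTransposes_of_isIso_mate (R.adj W X) (R.adj Z X) (m ▷ X) m (whiskerRight_fst m X).symm
    (R.beckChevalley m X)

end Comprehension

/-! ### The universal property of the evaluation map -/

section Evaluation

open CartesianMonoidalCategory

variable {C : Type u} [Category.{v} C] [CartesianMonoidalCategory C]
  {D : IndexedCat.{v, u, v₁, u₁} C} {T : IndexedTerminal D} {K : Comprehension T}
  (S : StrongSigma K) (P : PiTypes K) (Δ : Democracy K)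
  {L : IndexedCat.{v, u, v₂, u₂} C} (R : ProjectionPi L) {O : FibreTensor L}
  (Q : Cotractable T O) (A B : Total L)

/-- Rewrites evaluation in the form occurring in `HasTransposes`: the generic element of the Π-type
is reindexed by `cyl` and then followed by the counit. `oneRe` corrects the source from the
reindexed terminal object to the chosen one. -/
lemma tmk_arg_evalElem :
    tmk (x := ⟨_, T.one (expBase S P Δ Q A B ⊗ A.base)⟩)
      (y := ⟨ctx₁ Δ A.base, sigmaType S Δ Q A B⟩) (arg S P Δ Q A B) (evalElem S P Δ Q A B) =
    (oneRe T (fst _ _)).hom ≫ cyl (K.counit (𝟙_ C) (piType S P Δ Q A B)) (fst _ _)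
      (K.p (𝟙_ C) (Δ.code A.base)) (arg S P Δ Q A B) (toUnit_unique _ _) ≫
        vert ((P.adj (Δ.code A.base)).counit.app (sigmaType S Δ Q A B)) := by
  have h : (oneRe T (fst _ _)).hom ≫ cyl (K.counit (𝟙_ C) (piType S P Δ Q A B)) (fst _ _)
      (K.p (𝟙_ C) (Δ.code A.base)) (arg S P Δ Q A B) (toUnit_unique _ _) =
      cartLift (oneMap T (fst (expBase S P Δ Q A B) A.base) ≫
        K.counit (𝟙_ C) (piType S P Δ Q A B)) (K.p (𝟙_ C) (Δ.code A.base))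
          (arg S P Δ Q A B) (toUnit_unique _ _) := by
    refine cart_hom_ext (y := ⟨𝟙_ C, piType S P Δ Q A B⟩)
      (Category.id_comp (arg S P Δ Q A B)) ?_
    refine Eq.trans ?_ (cartLift_comp_cart _ _ _ _).symm
    rw [Category.assoc]
    refine (congrArg (_ ≫ ·) (cyl_comp_cart _ _ _ _ _)).trans ?_
    rw [← Category.assoc]
    refine congrArg (· ≫ _) (oneRe_hom_comp_cart _)
  rw [← Category.assoc, h]
  refine Eq.trans ?_ (tmk_comp_vert _ _ _).symm
  refine congrArg (tmk (x := ⟨_, T.one (expBase S P Δ Q A B ⊗ A.base)⟩)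
      (y := ⟨ctx₁ Δ A.base, sigmaType S Δ Q A B⟩) (arg S P Δ Q A B)) ?_
  refine Eq.trans ?_ (congrArg (fun t => (t ≫ (reC D (arg S P Δ Q A B)
    (K.p (𝟙_ C) (Δ.code A.base)) (fst _ _ ≫ K.p (𝟙_ C) (piType S P Δ Q A B))
      (toUnit_unique _ _) _).inv) ≫ (re D (arg S P Δ Q A B)).map
        ((P.adj (Δ.code A.base)).counit.app (sigmaType S Δ Q A B)))
    (K.tfib_oneMap_comp_counit (fst (expBase S P Δ Q A B) A.base))).symm
  simp only [evalElem, reSquare_hom_app, Category.assoc]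

lemma evalMap_p : evalMap S P Δ Q A B ≫ K.p _ _ = arg S P Δ Q A B :=
  K.classify_comp_p _

/-- Precomposing evaluation with m × X replaces the generic element by the element that `m`
classifies, so evaluating `m` is taking its transpose. -/
lemma classify_symm_whiskerRight_comp_evalMap {Z : C} (m : Z ⟶ expBase S P Δ Q A B) :
    K.classify.symm (m ▷ A.base ≫ evalMap S P Δ Q A B) =
      (oneRe T (fst Z A.base)).hom ≫
        cyl (K.classify.symm m) (fst Z A.base)
          (K.p (𝟙_ C) (Δ.code A.base)) (snd Z A.base ≫ (Δ.iso A.base).inv)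
            (toUnit_unique _ _) ≫
        vert ((P.adj (Δ.code A.base)).counit.app (sigmaType S Δ Q A B)) := by
  have h : K.classify.symm (evalMap S P Δ Q A B) = _ := K.classify.symm_apply_apply _
  rw [K.classify_symm_comp, h, tmk_arg_evalElem, ← Category.assoc, ← Category.assoc,
    ← Category.assoc]
  refine congrArg (· ≫ _) ?_
  rw [oneMap_comp_oneRe_hom (fst Z A.base) (fst _ _) (m ▷ A.base) m (by simp),
    Category.assoc]
  refine congrArg (_ ≫ ·) ((cyl_comp_cyl (oneMap T m) (K.counit _ _) _ _ _ _ _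
    (snd Z A.base ≫ (Δ.iso A.base).inv) _ _ ?_ (toUnit_unique _ _)).trans ?_)
  · simp [arg]
  · simp only [K.classify_symm]

/-- Global maps into the Π-type are sections over Z × X: a map `k` over `X` classifies an element,
whose unique transpose along the Π-adjunction classifies `m`. -/
lemma existsUnique_evalMap {Z : C}
    (k : Z ⊗ A.base ⟶ K.ctx (ctx₁ Δ A.base) (sigmaType S Δ Q A B))
    (hk : k ≫ K.p _ _ = snd Z A.base ≫ (Δ.iso A.base).inv) :
    ∃! m : Z ⟶ expBase S P Δ Q A B, m ▷ A.base ≫ evalMap S P Δ Q A B = k := by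
  -- Transposes start from `fst^* 1`, elements from `1`; the inverse of `oneRe` mediates.
  obtain ⟨Ψ, ⟨h₁, h₂⟩, h₃⟩ := P.hasTransposes Δ Z A.base (T.one Z) (sigmaType S Δ Q A B)
    ((oneRe T (fst Z A.base)).inv ≫ K.classify.symm k)
    ((Category.id_comp _).trans ((K.tbase_classify_symm k).trans hk))
  refine ⟨K.classify Ψ, ?_, ?_⟩
  · refine K.classify.symm.injective ?_
    rw [classify_symm_whiskerRight_comp_evalMap, ← Iso.eq_inv_comp]
    simp only [Equiv.symm_apply_apply]
    exact h₂
  · rintro m rfl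
    rw [← K.classify.symm_apply_eq]
    refine h₃ _ ⟨toUnit_unique _ _, ?_⟩
    rw [Iso.eq_inv_comp]
    exact (classify_symm_whiskerRight_comp_evalMap S P Δ Q A B m).symm

end Evaluation

/-! ### Morphisms into the exponential as morphisms over X into the generic residual -/

section Zeta

open CartesianMonoidalCategory

variable {C : Type u} [Category.{v} C] [CartesianMonoidalCategory C]
  {D : IndexedCat.{v, u, v₁, u₁} C} {T : IndexedTerminal D} {K : Comprehension T}
  (S : StrongSigma K) (P : PiTypes K) (Δ : Democracy K)
  {L : IndexedCat.{v, u, v₂, u₂} C} (R : ProjectionPi L) {O : FibreTensor L}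
  (Q : Cotractable T O) (A B : Total L)

/-- The projection of the context `X.Y.(T x ⊸ y)` to `X`. -/
abbrev proj₁ : ctx₃ Δ Q A B ⟶ A.base := K.p _ (homType Δ Q A B) ≫ pr₁ Δ A.base B.base

/-- The projection of the context `X.Y.(T x ⊸ y)` to `Y`. -/
abbrev proj₂ : ctx₃ Δ Q A B ⟶ B.base := K.p _ (homType Δ Q A B) ≫ pr₂ Δ A.base B.base

lemma zeta_comp_proj₁ : zeta S P Δ Q A B ≫ proj₁ Δ Q A B = snd _ _ := by
  have h : zeta S P Δ Q A B ≫ K.p _ (homType Δ Q A B) ≫ K.p _ (wk Δ A.base B.base) =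
      arg S P Δ Q A B := by
    rw [← S.pair_hom_comp_p, zeta, Category.assoc, Iso.inv_hom_id_assoc, evalMap_p]
  rw [proj₁, pr₁, reassoc_of% h, arg, Category.assoc, Iso.inv_hom_id, Category.comp_id]

/-- The strong Σ isomorphism commutes with the projections to `X`, so it carries the universal
property of evaluation over to `zeta`. -/
lemma existsUnique_zeta {Z : C} (k : Z ⊗ A.base ⟶ ctx₃ Δ Q A B)
    (hk : k ≫ proj₁ Δ Q A B = snd _ _) :
    ∃! m : Z ⟶ expBase S P Δ Q A B, m ▷ A.base ≫ zeta S P Δ Q A B = k := by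
  have h : (k ≫ (S.pair (wk Δ A.base B.base) (homType Δ Q A B)).hom) ≫ K.p _ _ =
      snd Z A.base ≫ (Δ.iso A.base).inv := by
    rw [Category.assoc, S.pair_hom_comp_p, ← hk, proj₁, pr₁]
    simp
  obtain ⟨m, h₁, h₂⟩ := existsUnique_evalMap S P Δ Q A B _ h
  refine ⟨m, ?_, fun m' h' => h₂ m' ?_⟩
  · change m ▷ A.base ≫ evalMap S P Δ Q A B = _ at h₁
    rw [zeta, reassoc_of% h₁, Iso.hom_inv_id, Category.comp_id]
  · change m' ▷ A.base ≫ evalMap S P Δ Q A B = _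
    rw [← h', zeta, Category.assoc, Category.assoc, Iso.inv_hom_id, Category.comp_id]

/-- The object `(X.Y.(T x ⊸ y), ∂v)` of `Σ_C L`. -/
abbrev residTotal : Total L := ⟨ctx₃ Δ Q A B, residGeneric Δ Q A B⟩

/-- The object `(X, x) ⊸ (Y, y)`, as a pair. -/
noncomputable abbrev expTotal : Total L :=
  ⟨expBase S P Δ Q A B, (R.pi (expBase S P Δ Q A B) A.base).obj
    ((re L (zeta S P Δ Q A B)).obj (residGeneric Δ Q A B))⟩

/-- The morphism into `(X.Y.(T x ⊸ y), ∂v)` induced by a morphism into `(X, x) ⊸ (Y, y)`, at the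
stage `V` with projections `c` and `a`. -/
noncomputable def uncurryAt {Z : Total L} (Ψ : Z ⟶ expTotal S P Δ R Q A B) {V : C}
    (c : V ⟶ Z.base) (a : V ⟶ A.base) :
    (⟨V, (re L c).obj Z.fiber⟩ : Total L) ⟶ residTotal Δ Q A B :=
  cyl Ψ c (fst _ A.base)
      (lift (c ≫ tbase Ψ) a) (lift_fst _ _) ≫
    vert ((R.adj (expBase S P Δ Q A B) A.base).counit.app _) ≫
    cart (y := residTotal Δ Q A B) (zeta S P Δ Q A B)

lemma tbase_uncurryAt {Z : Total L} (Ψ : Z ⟶ expTotal S P Δ R Q A B) {V : C}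
    (c : V ⟶ Z.base) (a : V ⟶ A.base) :
    tbase (uncurryAt S P Δ R Q A B Ψ c a) = lift (c ≫ tbase Ψ) a ≫ zeta S P Δ Q A B :=
  congrArg (lift (c ≫ tbase Ψ) a ≫ ·) (Category.id_comp (zeta S P Δ Q A B))

lemma tbase_uncurryAt_comp_proj₁ {Z : Total L} (Ψ : Z ⟶ expTotal S P Δ R Q A B) {V : C}
    (c : V ⟶ Z.base) (a : V ⟶ A.base) :
    tbase (uncurryAt S P Δ R Q A B Ψ c a) ≫ proj₁ Δ Q A B = a := by
  rw [tbase_uncurryAt, Category.assoc, zeta_comp_proj₁]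
  exact lift_snd _ _

lemma cyl_comp_uncurryAt {Z Z' : Total L} (Φ : Z ⟶ Z') (Ψ : Z' ⟶ expTotal S P Δ R Q A B)
    {V V' : C} (c : V ⟶ Z.base) (a : V ⟶ A.base) (c' : V' ⟶ Z'.base) (a' : V' ⟶ A.base)
    (θ : V ⟶ V') (h₁ : θ ≫ c' = c ≫ tbase Φ) (h₂ : θ ≫ a' = a) :
    cyl Φ c c' θ h₁ ≫ uncurryAt S P Δ R Q A B Ψ c' a' =
      uncurryAt S P Δ R Q A B (Φ ≫ Ψ) c a := by
  rw [uncurryAt, uncurryAt, ← Category.assoc]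
  refine congrArg (· ≫ _) (cyl_comp_cyl _ _ _ _ _ _ _ _ _ _ ?_ _)
  rw [comp_lift, h₂, tbase_comp, reassoc_of% h₁]

/-- `existsUnique_zeta` determines the base of `Ψ`, and Beck–Chevalley for the non-dependent Π-types
of `L` determines its fibre part. The stage `V` is only isomorphic to the product, so that both
orders of the factors are covered. -/
lemma existsUnique_uncurryAt {Z : Total L} {V : C} (j : V ≅ Z.base ⊗ A.base)
    (c : V ⟶ Z.base) (a : V ⟶ A.base) (hc : j.hom ≫ fst _ _ = c) (ha : j.hom ≫ snd _ _ = a)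
    (Θ : (⟨V, (re L c).obj Z.fiber⟩ : Total L) ⟶ residTotal Δ Q A B)
    (hΘ : tbase Θ ≫ proj₁ Δ Q A B = a) :
    ∃! Ψ : Z ⟶ expTotal S P Δ R Q A B, uncurryAt S P Δ R Q A B Ψ c a = Θ := by
  have key : ∀ m : Z.base ⟶ expBase S P Δ Q A B,
      j.hom ≫ m ▷ A.base = lift (c ≫ m) a := by
    intro m
    subst hc ha
    ext <;> simp
  obtain ⟨m, h₁, h₂⟩ := existsUnique_zeta S P Δ Q A B (j.inv ≫ tbase Θ) (by
    rw [Category.assoc]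
    refine (congrArg (j.inv ≫ ·) hΘ).trans ?_
    rw [← ha, Iso.inv_hom_id_assoc])
  have h₁ : m ▷ A.base ≫ zeta S P Δ Q A B = j.inv ≫ tbase Θ := h₁
  -- With `m` fixed, `Θ` is factored through the cartesian morphism over `zeta`; the factor lands in
  -- ζ^*(∂v), the object to which Π_X is applied, and can be transposed.
  obtain ⟨Φ, ⟨h₃, h₄⟩, h₅⟩ := existsUnique_comp_cart (y := residTotal Δ Q A B)
    (zeta S P Δ Q A B) (lift (c ≫ m) a) Θ (by
      rw [← key m, Category.assoc, h₁, Iso.hom_inv_id_assoc])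
  obtain ⟨Ψ, ⟨h₆, h₇⟩, h₈⟩ := (R.hasTransposes m A.base).of_iso j c (lift (c ≫ m) a) hc (key m)
    Z.fiber ((re L (zeta S P Δ Q A B)).obj (residGeneric Δ Q A B)) Φ h₃
  refine ⟨Ψ, ?_, ?_⟩
  · subst h₆
    refine Eq.trans ?_ h₄
    rw [← h₇]
    exact (Category.assoc _ _ _).symm
  · intro Ψ' h'
    have hm : tbase Ψ' = m := by
      refine h₂ _ ?_
      change tbase Ψ' ▷ A.base ≫ zeta S P Δ Q A B = _
      rw [Iso.eq_inv_comp, ← h', ← Category.assoc, key]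
      exact (tbase_uncurryAt S P Δ R Q A B Ψ' c a).symm
    subst hm
    refine h₈ Ψ' ⟨rfl, h₅ _ ⟨Category.comp_id _, ?_⟩⟩
    exact (Category.assoc _ _ _).trans h'

end Zeta

/-! ### The universal property of the generic residual -/

section Generic

variable {C : Type u} [Category.{v} C] [CartesianMonoidalCategory C]
  {D : IndexedCat.{v, u, v₁, u₁} C} {T : IndexedTerminal D} {K : Comprehension T}
  (Δ : Democracy K) {L : IndexedCat.{v, u, v₂, u₂} C} {O : FibreTensor L}
  (Q : Cotractable T O) (A B : Total L)

open scoped Prod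

/-- The element of `T a^*x ⊸ f^*y` classified by a map into the context `X.Y.(T x ⊸ y)`. -/
def elementAt {V : C} (k : V ⟶ ctx₃ Δ Q A B) (a : V ⟶ A.base) (f : V ⟶ B.base)
    (w₁ : k ≫ proj₁ Δ Q A B = a) (w₂ : k ≫ proj₂ Δ Q A B = f) :
    T.one V ⟶ (Q.hom V).obj (op ((re L a).obj A.fiber), (re L f).obj B.fiber) :=
  ((Q.elemRe T k).obj (Q.elem T (genericHom Δ Q A B))).hom ≫
    (Q.hom V).map ((reC₂ L k _ _ a w₁ A.fiber).inv.op ×ₘ (reC₂ L k _ _ f w₂ B.fiber).hom)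

/-- Reindexing the generic element along `k` agrees, up to canonical isomorphisms, with the element
that comprehension assigns to `k`. This rests on the compositor axiom `homRe_comp` of the indexed
hom. -/
lemma elementAt_eq {V : C} (k : V ⟶ ctx₃ Δ Q A B) (a : V ⟶ A.base) (f : V ⟶ B.base)
    (w₁ : k ≫ proj₁ Δ Q A B = a) (w₂ : k ≫ proj₂ Δ Q A B = f)
    (g : V ⟶ ctx₂ Δ A.base B.base) (w : k ≫ K.p _ _ = g)
    (e₁ : g ≫ pr₁ Δ A.base B.base = a) (e₂ : g ≫ pr₂ Δ A.base B.base = f) :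
    elementAt Δ Q A B k a f w₁ w₂ = K.element k g w ≫ (Q.homReIso g _ _).inv ≫
      (Q.hom V).map ((reC L g _ a e₁ A.fiber).inv.op ×ₘ (reC L g _ f e₂ B.fiber).hom) := by
  have e : (Q.homReIso k _ _).hom ≫ (re D k).map (Q.homReIso (K.p _ (homType Δ Q A B)) _ _).hom ≫
      (reC D k _ g w _).hom = _ ≫ (Q.homReIso g _ _).hom :=
    Q.homRe_comp k (K.p _ (homType Δ Q A B)) g w
      ((re L (pr₁ Δ A.base B.base)).obj A.fiber) ((re L (pr₂ Δ A.base B.base)).obj B.fiber)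
  have e' : (re D k).map (Q.homReIso (K.p _ (homType Δ Q A B)) _ _).inv ≫
      (Q.homReIso k _ _).inv ≫ (Q.hom V).map ((reC L k _ g w _).inv.op ×ₘ (reC L k _ g w _).hom) =
        (reC D k _ g w _).hom ≫ (Q.homReIso g ((re L (pr₁ Δ A.base B.base)).obj A.fiber)
          ((re L (pr₂ Δ A.base B.base)).obj B.fiber)).inv := by
    rw [Iso.eq_comp_inv, Category.assoc, Category.assoc, ← e, Iso.inv_hom_id_assoc,
      ← Functor.map_comp_assoc, Iso.inv_hom_id, CategoryTheory.Functor.map_id, Category.id_comp]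
  have h : (elementAt Δ Q A B k a f w₁ w₂) = ((T.reIsTerminal k).from (T.one V) ≫
      (re D k).map (K.gen _ (homType Δ Q A B) ≫ (Q.homReIso (K.p _ (homType Δ Q A B)) _ _).inv) ≫
        (Q.homReIso k _ _).inv) ≫
      (Q.hom V).map ((reC₂ L k _ _ a w₁ A.fiber).inv.op ×ₘ (reC₂ L k _ _ f w₂ B.fiber).hom) := rfl
  rw [h, ← reC_trans_reC L k _ _ a w₁ A.fiber g w e₁, ← reC_trans_reC L k _ _ f w₂ B.fiber g w e₂]
  have h' : (Q.hom V).map (((reC L k _ g w _ ≪≫ reC L g _ a e₁ A.fiber).inv.op ×ₘ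
      (reC L k _ g w _ ≪≫ reC L g _ f e₂ B.fiber).hom)) =
    (Q.hom V).map ((reC L k _ g w _).inv.op ×ₘ (reC L k _ g w _).hom) ≫
      (Q.hom V).map ((reC L g _ a e₁ A.fiber).inv.op ×ₘ (reC L g _ f e₂ B.fiber).hom) := by
    rw [← Functor.map_comp]
    rfl
  rw [h', Functor.map_comp, Category.assoc, Category.assoc, Category.assoc, reassoc_of% e',
    Comprehension.element, Category.assoc, Category.assoc]

/-- The maps `a` and `f` fix the component `g` into `X.Y`; by comprehension the remaining freedom in
`k` is an element of the reindexed hom type, and the isomorphism `I` identifies this with an element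
of T a^*x ⊸ f^*y. -/
lemma existsUnique_elementAt {V : C} (a : V ⟶ A.base) (f : V ⟶ B.base)
    (s : T.one V ⟶ (Q.hom V).obj (op ((re L a).obj A.fiber), (re L f).obj B.fiber)) :
    ∃! k : V ⟶ ctx₃ Δ Q A B, ∃ w₁ w₂, elementAt Δ Q A B k a f w₁ w₂ = s := by
  obtain ⟨g, ⟨e₁, e₂⟩, hg⟩ := existsUnique_ctx₂_lift Δ a f
  let i : ((op ((re L g).obj ((re L (pr₁ Δ A.base B.base)).obj A.fiber)),
        (re L g).obj ((re L (pr₂ Δ A.base B.base)).obj B.fiber)) : (fib L V)ᵒᵖ × fib L V) ≅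
      (op ((re L a).obj A.fiber), (re L f).obj B.fiber) :=
    Iso.prod (reC L g _ a e₁ A.fiber).symm.op (reC L g _ f e₂ B.fiber)
  let I := (Q.homReIso g _ _).symm ≪≫ (Q.hom V).mapIso i
  have hI : ∀ (k : V ⟶ ctx₃ Δ Q A B) (w₁ : k ≫ proj₁ Δ Q A B = a) (w₂ : k ≫ proj₂ Δ Q A B = f)
      (w : k ≫ K.p _ _ = g), elementAt Δ Q A B k a f w₁ w₂ = K.element k g w ≫ I.hom :=
    fun k w₁ w₂ w => elementAt_eq Δ Q A B k a f w₁ w₂ g w e₁ e₂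
  obtain ⟨k, w, hk⟩ := K.exists_element_eq g (s ≫ I.inv)
  refine ⟨k, ⟨?_, ?_, ?_⟩, ?_⟩
  · rw [proj₁, reassoc_of% w, e₁]
  · rw [proj₂, reassoc_of% w, e₂]
  · rw [hI k _ _ w, hk, Category.assoc, Iso.inv_hom_id, Category.comp_id]
  · rintro k' ⟨w₁, w₂, h⟩
    have w' : k' ≫ K.p _ _ = g := hg _ ⟨by rw [Category.assoc, w₁], by rw [Category.assoc, w₂]⟩
    refine K.element_injective w' w ?_
    rw [hk, ← h, hI k' _ _ w', Category.assoc, Iso.hom_inv_id, Category.comp_id]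

/-- The universal morphism `x ⊗ ∂v ⟶ y` over the context `X.Y.(T x ⊸ y)`. -/
def residEval :
    (⟨ctx₃ Δ Q A B, ((O.tensor _).obj ((re L (proj₁ Δ Q A B)).obj A.fiber)).obj
      (residGeneric Δ Q A B)⟩ : Total L) ⟶ B :=
  tmk (x := ⟨ctx₃ Δ Q A B, ((O.tensor _).obj ((re L (proj₁ Δ Q A B)).obj A.fiber)).obj
      (residGeneric Δ Q A B)⟩) (proj₂ Δ Q A B)
    (O.map₂ (reC L _ _ (proj₁ Δ Q A B) rfl A.fiber).inv (𝟙 _) ≫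
      (Q.homEquiv _ _ _).symm ⟨genericHom Δ Q A B, 𝟙 _⟩ ≫
        (reC L _ _ (proj₂ Δ Q A B) rfl B.fiber).hom)

/-- The morphism `a^*x ⊗ c ⟶ f^*y` induced by a morphism `(V, c) ⟶ (X.Y.(T x ⊸ y), ∂v)`. -/
def residEvalAt {V : C} {c : fib L V} (k : V ⟶ ctx₃ Δ Q A B)
    (h : c ⟶ (re L k).obj (residGeneric Δ Q A B)) (a : V ⟶ A.base) (f : V ⟶ B.base)
    (w₁ : k ≫ proj₁ Δ Q A B = a) (w₂ : k ≫ proj₂ Δ Q A B = f) :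
    ((O.tensor V).obj ((re L a).obj A.fiber)).obj c ⟶ (re L f).obj B.fiber :=
  O.map₂ (reC₂ L k _ _ a w₁ A.fiber).inv h ≫
    ((O.comparison k _ _).hom ≫ (re L k).map ((Q.homEquiv _ _ _).symm
      ⟨genericHom Δ Q A B, 𝟙 _⟩)) ≫ (reC₂ L k _ _ f w₂ B.fiber).hom

/-- Puts the composite in the shape required by `homEquiv_re` and `homEquiv_natural`: a reindexed
universal morphism between canonical isomorphisms. -/
lemma act_comp_residEval (hO : O.IsCoherent) {V : C} {c : fib L V}
    (Θ : (⟨V, c⟩ : Total L) ⟶ residTotal Δ Q A B) (a : V ⟶ A.base) (f : V ⟶ B.base)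
    (w₁ : tbase Θ ≫ proj₁ Δ Q A B = a) (w₂ : tbase Θ ≫ proj₂ Δ Q A B = f) :
    act O A.fiber Θ a (proj₁ Δ Q A B) w₁ ≫ residEval Δ Q A B =
      tmk (x := ⟨V, ((O.tensor V).obj ((re L a).obj A.fiber)).obj c⟩) f
        (residEvalAt Δ Q A B (tbase Θ) (tfib Θ) a f w₁ w₂) := by
  subst w₂
  refine (tmk_comp_tmk _ _ _ _).trans ?_
  refine congrArg (tmk (x := ⟨V, ((O.tensor V).obj ((re L a).obj A.fiber)).obj c⟩)
    (tbase (x := ⟨V, c⟩) (y := residTotal Δ Q A B) Θ ≫ proj₂ Δ Q A B)) ?_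
  rw [Functor.map_comp, Functor.map_comp, Category.assoc, Category.assoc, Category.assoc,
    reassoc_of% hO.natural, reassoc_of% O.map₂_comp, CategoryTheory.Functor.map_id,
    Category.comp_id]
  simp only [residEvalAt, reC₂, Iso.trans_inv, Iso.trans_hom, Functor.mapIso_inv,
    Functor.mapIso_hom, Category.assoc]

/-- The comparison of `k^* ∂v` with `∂` of the element classified by `k`. -/
def residComparison {V : C} (k : V ⟶ ctx₃ Δ Q A B) (a : V ⟶ A.base) (f : V ⟶ B.base)
    (w₁ : k ≫ proj₁ Δ Q A B = a) (w₂ : k ≫ proj₂ Δ Q A B = f) :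
    (re L k).obj (residGeneric Δ Q A B) ≅
      (Q.resid V).obj (Q.elem T (elementAt Δ Q A B k a f w₁ w₂)) :=
  (Q.residRe k).symm.app (Q.elem T (genericHom Δ Q A B)) ≪≫
    (Q.resid V).mapIso (StructuredArrow.isoMk
      (Iso.prod (reC₂ L k _ _ a w₁ A.fiber).symm.op (reC₂ L k _ _ f w₂ B.fiber)) rfl)

/-- A Yoneda argument: the universal morphism corresponds to the pair of generic element and
identity, and the cotractability bijection respects reindexing along `k` and composition on both
sides. -/
lemma homEquiv_residEvalAt {V : C} {c : fib L V} (k : V ⟶ ctx₃ Δ Q A B)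
    (h : c ⟶ (re L k).obj (residGeneric Δ Q A B)) (a : V ⟶ A.base) (f : V ⟶ B.base)
    (w₁ : k ≫ proj₁ Δ Q A B = a) (w₂ : k ≫ proj₂ Δ Q A B = f) :
    Q.homEquiv _ _ _ (residEvalAt Δ Q A B k h a f w₁ w₂) =
      ⟨elementAt Δ Q A B k a f w₁ w₂, h ≫ (residComparison Δ Q A B k a f w₁ w₂).hom⟩ := by
  rw [residEvalAt, FibreTensor.map₂, Category.assoc, Q.homEquiv_natural, Q.homEquiv_re,
    Equiv.apply_symm_apply]
  -- The first components agree by definition of `elementAt`, so only an equality in a single fibre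
  -- is left.
  refine congrArg (Sigma.mk _) ?_
  refine congrArg (h ≫ ·) ?_
  refine congrArg (· ≫ _) ?_
  exact (congrArg (· ≫ _) (CategoryTheory.Functor.map_id _ _)).trans (Category.id_comp _)

/-- Decomposing `G` by cotractability yields an element `s` and a map `t` into its residual. The
element determines the base of `Θ`, and `t` determines its fibre part through `residComparison`. -/
lemma existsUnique_act_comp_residEval (hO : O.IsCoherent) {V : C} {c : fib L V} (a : V ⟶ A.base)
    (G : (⟨V, ((O.tensor V).obj ((re L a).obj A.fiber)).obj c⟩ : Total L) ⟶ B) :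
    ∃! Θ : (⟨V, c⟩ : Total L) ⟶ residTotal Δ Q A B, ∃ w : tbase Θ ≫ proj₁ Δ Q A B = a,
      act O A.fiber Θ a (proj₁ Δ Q A B) w ≫ residEval Δ Q A B = G := by
  obtain ⟨f, φ⟩ := G
  change V ⟶ B.base at f
  change ((O.tensor V).obj ((re L a).obj A.fiber)).obj c ⟶ (re L f).obj B.fiber at φ
  obtain ⟨⟨s, t⟩, hφ⟩ : ∃ st, Q.homEquiv _ _ _ φ = st := ⟨_, rfl⟩
  obtain ⟨k, ⟨w₁, w₂, hk⟩, hk'⟩ := existsUnique_elementAt Δ Q A B a f s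
  subst hk
  refine ⟨tmk (x := ⟨V, c⟩) (y := residTotal Δ Q A B) k
    (t ≫ (residComparison Δ Q A B k a f w₁ w₂).inv), ⟨w₁, ?_⟩, ?_⟩
  · refine (act_comp_residEval Δ Q A B hO (tmk (x := ⟨V, c⟩) (y := residTotal Δ Q A B) k _)
      a f w₁ w₂).trans ?_
    refine congrArg (tmk (x := ⟨V, ((O.tensor V).obj ((re L a).obj A.fiber)).obj c⟩) f) ?_
    refine (Q.homEquiv _ _ _).injective ?_
    refine (homEquiv_residEvalAt Δ Q A B k _ a f w₁ w₂).trans (Eq.trans ?_ hφ.symm)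
    rw [tfib_mk, Category.assoc, Iso.inv_hom_id, Category.comp_id]
  · rintro ⟨k', h'⟩ ⟨w₁', e⟩
    change V ⟶ ctx₃ Δ Q A B at k'
    change c ⟶ (re L k').obj (residGeneric Δ Q A B) at h'
    have w₂' : k' ≫ proj₂ Δ Q A B = f := congrArg tbase e
    have e' := tmk_injective (x := ⟨V, ((O.tensor V).obj ((re L a).obj A.fiber)).obj c⟩) f
      ((act_comp_residEval Δ Q A B hO
        (tmk (x := ⟨V, c⟩) (y := residTotal Δ Q A B) k' h') a f w₁' w₂').symm.trans e)
    have e'' := (homEquiv_residEvalAt Δ Q A B k' h' a f w₁' w₂').symm.trans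
      ((congrArg (Q.homEquiv _ _ _) e').trans hφ)
    -- Once the base maps are identified, the first components coincide and the heterogeneous
    -- equality of second components becomes an ordinary one.
    obtain rfl := hk' k' ⟨w₁', w₂', congrArg Sigma.fst e''⟩
    refine congrArg (tmk (x := ⟨V, c⟩) (y := residTotal Δ Q A B) k') ?_
    rw [Iso.eq_comp_inv]
    exact eq_of_heq (Sigma.mk.inj e'').2

end Generic

/-! ### The adjunction bijections and their naturality -/

section Adjunction

open CartesianMonoidalCategory

variable {C : Type u} [Category.{v} C] [CartesianMonoidalCategory C]
  {D : IndexedCat.{v, u, v₁, u₁} C} {T : IndexedTerminal D} {K : Comprehension T}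
  (S : StrongSigma K) (P : PiTypes K) (Δ : Democracy K)
  {L : IndexedCat.{v, u, v₂, u₂} C} (R : ProjectionPi L)

section

variable {O : FibreTensor L} (Q : Cotractable T O) (A B : Total L)

/-- The morphism `a^*x ⊗ c^*z ⟶ y` induced by a morphism `(Z, z) ⟶ ((X, x) ⊸ (Y, y))`. -/
noncomputable def evalAt {Z : Total L} (Ψ : Z ⟶ expTotal S P Δ R Q A B) {V : C}
    (c : V ⟶ Z.base) (a : V ⟶ A.base) :
    (⟨V, ((O.tensor V).obj ((re L a).obj A.fiber)).obj ((re L c).obj Z.fiber)⟩ : Total L) ⟶ B :=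
  act O A.fiber (uncurryAt S P Δ R Q A B Ψ c a) a (proj₁ Δ Q A B)
    (tbase_uncurryAt_comp_proj₁ S P Δ R Q A B Ψ c a) ≫ residEval Δ Q A B

variable {Q A B}

/-- `evalAt` is `uncurryAt` followed by tensoring and evaluation; the two unique-existence
statements invert these in turn. -/
lemma evalAt_bijective (hO : O.IsCoherent) {Z : Total L} {V : C} (j : V ≅ Z.base ⊗ A.base)
    (c : V ⟶ Z.base) (a : V ⟶ A.base) (hc : j.hom ≫ fst _ _ = c) (ha : j.hom ≫ snd _ _ = a) :
    Function.Bijective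
      (fun Ψ : Z ⟶ expTotal S P Δ R Q A B => evalAt S P Δ R Q A B Ψ c a) := by
  rw [Function.bijective_iff_existsUnique]
  intro G
  obtain ⟨Θ, ⟨w, h₁⟩, h₂⟩ := existsUnique_act_comp_residEval Δ Q A B hO a G
  obtain ⟨Ψ, h₃, h₄⟩ := existsUnique_uncurryAt S P Δ R Q A B j c a hc ha Θ w
  refine ⟨Ψ, ?_, fun Ψ' h' => h₄ Ψ' (h₂ _ ⟨_, h'⟩)⟩
  subst h₃
  exact h₁

/-- Naturality in the source: functoriality of `act` reduces it to the naturality of `uncurryAt`. -/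
lemma act_cyl_comp_evalAt (hO : O.IsCoherent) {Z Z' : Total L} (Φ : Z ⟶ Z')
    (Ψ : Z' ⟶ expTotal S P Δ R Q A B) {V V' : C} (c : V ⟶ Z.base) (a : V ⟶ A.base)
    (c' : V' ⟶ Z'.base) (a' : V' ⟶ A.base) (θ : V ⟶ V') (h₁ : θ ≫ c' = c ≫ tbase Φ)
    (h₂ : θ ≫ a' = a) :
    act O A.fiber (cyl Φ c c' θ h₁) a a' h₂ ≫ evalAt S P Δ R Q A B Ψ c' a' =
      evalAt S P Δ R Q A B (Φ ≫ Ψ) c a := by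
  rw [evalAt, evalAt, ← Category.assoc]
  refine congrArg (· ≫ _) ?_
  refine (act_comp hO A.fiber (cyl Φ c c' θ h₁) (uncurryAt S P Δ R Q A B Ψ c' a') a a' _ h₂ _
    ?_).trans ?_
  · rw [cyl_comp_uncurryAt S P Δ R Q A B Φ Ψ c a c' a' θ h₁ h₂]
    exact tbase_uncurryAt_comp_proj₁ S P Δ R Q A B (Φ ≫ Ψ) c a
  · simp only [cyl_comp_uncurryAt S P Δ R Q A B Φ Ψ c a c' a' θ h₁ h₂]

end

variable [IndexedMonoidal L]

/-- The hom-set bijection for the left closed structure. -/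
noncomputable def leftClosedEquiv (Q : Cotractable T (FibreTensor.standard L)) (A Z B : Total L) :
    ((tensorLeft A).obj Z ⟶ B) ≃ (Z ⟶ dialecticaHom S P Δ R Q A B) :=
  (Equiv.ofBijective _ (evalAt_bijective S P Δ R (Q := Q) (A := A) (B := B)
    (standard_isCoherent L)
    -- The swap of factors: A ⊗ Z has base X × Z, while the Π-types are taken along Z × X ⟶ Z.
    ⟨lift (snd A.base Z.base) (fst A.base Z.base), lift (snd Z.base A.base) (fst Z.base A.base),
      by ext <;> simp, by ext <;> simp⟩ (snd A.base Z.base) (fst A.base Z.base)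
    (by simp) (by simp))).symm

/-- The hom-set bijection for the right closed structure. -/
noncomputable def rightClosedEquiv (Q : Cotractable T (FibreTensor.reversed L))
    (A Z B : Total L) :
    ((tensorRight A).obj Z ⟶ B) ≃ (Z ⟶ dialecticaHom S P Δ R Q A B) :=
  (Equiv.ofBijective _ (evalAt_bijective S P Δ R (Q := Q) (A := A) (B := B)
    (reversed_isCoherent L) (Iso.refl (Z.base ⊗ A.base)) (fst Z.base A.base) (snd Z.base A.base)
    (by simp) (by simp))).symm

/-- Checked on the inverse bijection `evalAt`, after rewriting A ⊗ Φ as an action on a reindexed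
morphism. -/
lemma leftClosedEquiv_naturality (Q : Cotractable T (FibreTensor.standard L)) (A : Total L)
    (Z' Z B : Total L) (Φ : Z' ⟶ Z) (G : (tensorLeft A).obj Z ⟶ B) :
    leftClosedEquiv S P Δ R Q A Z' B ((tensorLeft A).map Φ ≫ G) =
      Φ ≫ leftClosedEquiv S P Δ R Q A Z B G := by
  obtain ⟨Ψ, rfl⟩ := (leftClosedEquiv S P Δ R Q A Z B).symm.surjective G
  rw [Equiv.apply_symm_apply, ← Equiv.eq_symm_apply]
  have h : (tensorLeft A).map Φ = _ := tensorHom_id_eq_act A Φ (A.base ◁ tbase Φ) (by simp) (by simp)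
  rw [h]
  exact act_cyl_comp_evalAt S P Δ R (standard_isCoherent L) Φ Ψ _ _ _ _ _ _ _

lemma rightClosedEquiv_naturality (Q : Cotractable T (FibreTensor.reversed L)) (A : Total L)
    (Z' Z B : Total L) (Φ : Z' ⟶ Z) (G : (tensorRight A).obj Z ⟶ B) :
    rightClosedEquiv S P Δ R Q A Z' B ((tensorRight A).map Φ ≫ G) =
      Φ ≫ rightClosedEquiv S P Δ R Q A Z B G := by
  obtain ⟨Ψ, rfl⟩ := (rightClosedEquiv S P Δ R Q A Z B).symm.surjective G
  rw [Equiv.apply_symm_apply, ← Equiv.eq_symm_apply]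
  have h : (tensorRight A).map Φ = _ := tensorHom_eq_act A Φ (tbase Φ ▷ A.base) (by simp) (by simp)
  rw [h]
  exact act_cyl_comp_evalAt S P Δ R (reversed_isCoherent L) Φ Ψ _ _ _ _ _ _ _

end Adjunction

end Dialectica

open Dialectica
theorem mainTheorem1 {C : Type u} [Category.{v} C] [CartesianMonoidalCategory C]
    (D : IndexedCat.{v, u, v₁, u₁} C) (T : IndexedTerminal D) (K : Comprehension T)
    (S : StrongSigma K) (P : PiTypes K) (Δ : Democracy K)
    (L : IndexedCat.{v, u, v₂, u₂} C) [IndexedMonoidal L] (R : ProjectionPi L) :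
    (∀ Q : Cotractable T (FibreTensor.standard L),
      ∃ c : MonoidalClosed (Total L), ∀ A B : Total L,
        (c.closed A).rightAdj.obj B = dialecticaHom S P Δ R Q A B) ∧
    (∀ Q : Cotractable T (FibreTensor.reversed L),
      ∃ G : Total L → Total L ⥤ Total L, ∀ A : Total L,
        Nonempty (tensorRight A ⊣ G A) ∧
          ∀ B : Total L, (G A).obj B = dialecticaHom S P Δ R Q A B) := by
  -- The object part of the adjoint is the prescribed formula and the bijections determine its
  -- action on morphisms, so the object formula holds by `rfl`.
  refine ⟨fun Q => ⟨⟨fun A => ⟨_, Adjunction.adjunctionOfEquivRight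
      (leftClosedEquiv S P Δ R Q A) (leftClosedEquiv_naturality S P Δ R Q A)⟩⟩, fun A B => rfl⟩,
    fun Q => ⟨fun A => _, fun A => ⟨⟨Adjunction.adjunctionOfEquivRight
      (rightClosedEquiv S P Δ R Q A) (rightClosedEquiv_naturality S P Δ R Q A)⟩, fun B => rfl⟩⟩⟩
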